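/- Let $\mathrm{Conv}_c(\mathbb{R}^n)$ be the set of convex, lower semicontinuous, proper functions $\psi\colon\mathbb{R}^n\to(-\infty,\infty]$ that are coercive, i.e. $\lim_{|x|\to\infty}\psi(x)=\infty$, and let $\mathrm{LC}_c(\mathbb{R}^n)=\{e^{-\psi}:\psi\in \mathrm{Conv}_c(\mathbb{R}^n)\}$. For $f,g\in\mathrm{LC}_c(\mathbb{R}^n)$ and $\lambda>0$ let $(f\star g)(x)=\sup_{y\in\mathbb{R}^n} f(y)g(x-y)$ (Asplund sum) and $(\lambda\cdot f)(x)=f(x/\lambda)^\lambda$. A sequence $f_j\in\mathrm{LC}_c(\mathbb{R}^n)$ hypo-converges to $f\in\mathrm{LC}_c(\mathbb{R}^n)$ if for every $x\in\mathbb{R}^n$ one has $\limsup_j f_j(x_j)\le f(x)$ for every sequence $x_j\to x$, and $\lim_j f_j(x_j)=f(x)$ for some sequence $x_j\to x$. Let $\mathcal{L}\psi(x)=\sup_{y\in\mathbb{R}^n}(\langle x,y\rangle-\psi(y))$ be the Legendre--Fenchel transform. For $\psi\in\mathrm{Conv}_c(\mathbb{R}^n)$ and $n\ge2$, the rotational epi-symmetrization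 $\psi_{\rm rot}$ is the function in $\mathrm{Conv}_c(\mathbb{R}^n)$ with $\mathcal{L}\psi_{\rm rot}(x)=\int_{\mathrm{SO}(n)}\mathcal{L}\psi(\vartheta^{-1}x)\,d\vartheta$ for all $x\in\mathbb{R}^n$, where the integration is with respect to the Haar probability measure on $\mathrm{SO}(n)$. For $n=1$, $\psi_{\rm rot}(x)=\tfrac12\inf_{y\in\mathbb{R}}\big(\psi(2x-y)+\psi(-y)\big)$. For $f=e^{-\psi}\in\mathrm{LC}_c(\mathbb{R}^n)$, the rotational hypo-symmetrization of $f$ is $f_{\rm rot}=e^{-\psi_{\rm rot}}$. Let $G\colon \mathrm{LC}_c(\mathbb{R}^n)\to[0,\infty]$ be a functional that does not attain both of the values $0$ and $\infty$, and suppose that $G$ is log-convex, that is, $G(\lambda\cdot f\star(1-\lambda)\cdot g)\le G(f)^\lambda G(g)^{1-\lambda}$ for all $f,g\in\mathrm{LC}_c(\mathbb{R}^n)$ and all $\lambda\in(0,1)$. (i) Let $n\ge 2$. If $G$ is lower semicontinuous with respect to hypo-convergence and invariant under rotations, i.e. $G(f\circ\vartheta)=G(f)$ for all $f\in\mathrm{LC}_c(\mathbb{R}^n)$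 and $\vartheta\in\mathrm{SO}(n)$, then for every $f\in\mathrm{LC}_c(\mathbb{R}^n)$ the function $f_{\rm rot}\in\mathrm{LC}_c(\mathbb{R}^n)$ exists, is unique, and satisfies $G(f_{\rm rot})\le G(f)$. (ii) Let $n=1$. If $G$ is invariant under reflections, i.e. $G(x\mapsto f(-x))=G(f)$ for all $f\in\mathrm{LC}_c(\mathbb{R})$, then (without assuming any semicontinuity of $G$) for every $f\in\mathrm{LC}_c(\mathbb{R})$ the function $f_{\rm rot}$ belongs to $\mathrm{LC}_c(\mathbb{R})$ and $G(f_{\rm rot})\le G(f)$. -/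

import Mathlib

open MeasureTheory Filter Topology
open scoped ENNReal

/-- `ℝⁿ` with its Euclidean structure. -/
abbrev Eucl (n : ℕ) : Type := EuclideanSpace ℝ (Fin n)

/-! ### The rotation group and its Haar probability measure -/

/-- The rotation group `SO(n)`, with the topology induced from the space of matrices. -/
abbrev SO (n : ℕ) : Type := Matrix.specialOrthogonalGroup (Fin n) ℝ

/-- The linear action of a rotation on `ℝⁿ`. -/
def SO.act {n : ℕ} (θ : SO n) (x : Eucl n) : Eucl n :=
  WithLp.toLp 2 (Matrix.mulVec (θ : Matrix (Fin n) (Fin n) ℝ) (WithLp.ofLp x))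

theorem SO.coe_inv {n : ℕ} (θ : SO n) :
    ((θ⁻¹ : SO n) : Matrix (Fin n) (Fin n) ℝ) = Matrix.transpose θ := rfl

instance SO.instIsTopologicalGroup (n : ℕ) : IsTopologicalGroup (SO n) where
  continuous_inv := by
    refine continuous_induced_rng.mpr ?_
    exact (continuous_subtype_val (p := fun A => A ∈
      Matrix.specialOrthogonalGroup (Fin n) ℝ)).matrix_transpose

instance SO.instCompactSpace (n : ℕ) : CompactSpace (SO n) := by
  have hclosed : IsClosed {A : Matrix (Fin n) (Fin n) ℝ |
      A * Matrix.transpose A = 1 ∧ A.det = 1} := by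
    refine IsClosed.inter ?_ ?_
    · exact isClosed_eq (continuous_id.matrix_mul continuous_id.matrix_transpose) continuous_const
    · exact isClosed_eq continuous_id.matrix_det continuous_const
  have hcompact : IsCompact (Set.pi Set.univ (fun _ : Fin n =>
      Set.pi Set.univ (fun _ : Fin n => Set.Icc (-1 : ℝ) 1))) :=
    isCompact_univ_pi fun _ => isCompact_univ_pi fun _ => isCompact_Icc
  have hset : {A : Matrix (Fin n) (Fin n) ℝ | A ∈ Matrix.specialOrthogonalGroup (Fin n) ℝ} =
      {A : Matrix (Fin n) (Fin n) ℝ | A * Matrix.transpose A = 1 ∧ A.det = 1} := by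
    ext A
    simp only [Set.mem_ofPred_eq, Matrix.mem_specialOrthogonalGroup_iff,
      Matrix.mem_orthogonalGroup_iff]
  have hgoal : IsCompact {A : Matrix (Fin n) (Fin n) ℝ |
      A ∈ Matrix.specialOrthogonalGroup (Fin n) ℝ} → CompactSpace (SO n) :=
    fun h => isCompact_iff_compactSpace.mp h
  refine hgoal ?_
  rw [hset]
  refine IsCompact.of_isClosed_subset hcompact hclosed ?_
  rintro A ⟨hA, -⟩ i - j -
  have h1 : ∑ k, A i k * A i k = 1 := by
    have := congrFun (congrFun hA i) i
    simpa [Matrix.mul_apply] using this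
  have h2 : A i j * A i j ≤ 1 := by
    rw [← h1]
    exact Finset.single_le_sum (f := fun k => A i k * A i k)
      (fun k _ => mul_self_nonneg _) (Finset.mem_univ j)
  exact abs_le.mp ((sq_le_one_iff_abs_le_one (A i j)).mp (by nlinarith))

instance SO.instMeasurableSpace (n : ℕ) : MeasurableSpace (SO n) := borel (SO n)

instance SO.instBorelSpace (n : ℕ) : BorelSpace (SO n) := ⟨rfl⟩

/-- The Haar probability measure on `SO(n)`. -/
noncomputable def SO.haar (n : ℕ) : Measure (SO n) := Measure.haarMeasure ⊤

instance SO.instIsProbabilityMeasure (n : ℕ) : IsProbabilityMeasure (SO.haar n) :=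
  ⟨Measure.haarMeasure_self (K₀ := (⊤ : TopologicalSpace.PositiveCompacts (SO n)))⟩

/-! ### Coercive convex functions -/

/-- Convexity of a function `ℝⁿ → (-∞, ∞]`. -/
def IsConvexFun {n : ℕ} (ψ : Eucl n → EReal) : Prop :=
  ∀ x y : Eucl n, ∀ a b : ℝ, 0 < a → 0 < b → a + b = 1 →
    ψ (a • x + b • y) ≤ (a : EReal) * ψ x + (b : EReal) * ψ y

/-- `Conv_c(ℝⁿ)`: the functions `ℝⁿ → (-∞, ∞]` that are convex, coercive, proper and lower
semicontinuous. -/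
structure IsConvC {n : ℕ} (ψ : Eucl n → EReal) : Prop where
  ne_bot : ∀ x, ψ x ≠ ⊥
  convex : IsConvexFun ψ
  coercive : Tendsto ψ (cocompact (Eucl n)) (𝓝 ⊤)
  proper : ∃ x, ψ x < ⊤
  lsc : LowerSemicontinuous ψ

/-- The Legendre-Fenchel transform. -/
noncomputable def legendre {n : ℕ} (ψ : Eucl n → EReal) (x : Eucl n) : EReal :=
  ⨆ y : Eucl n, (((inner ℝ x y : ℝ) : EReal) - ψ y)

/-- The infimal convolution. -/
noncomputable def infConv {n : ℕ} (ψ₁ ψ₂ : Eucl n → EReal) (x : Eucl n) : EReal :=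
  ⨅ y : Eucl n, (ψ₁ (x - y) + ψ₂ y)

/-- The epi-multiplication `x ↦ l ψ(x / l)`, for `l > 0`. -/
noncomputable def epiMul {n : ℕ} (l : ℝ) (ψ : Eucl n → EReal) (x : Eucl n) : EReal :=
  (l : EReal) * ψ (l⁻¹ • x)

/-- The integral of an extended-real-valued function, as the integral of its positive part minus
that of its negative part (the latter is finite wherever this is used below). -/
noncomputable def erealIntegral {α : Type*} [MeasurableSpace α] (μ : Measure α) (u : α → EReal) :
    EReal :=
  ((∫⁻ a, (u a).toENNReal ∂μ : ℝ≥0∞) : EReal) - ((∫⁻ a, (-u a).toENNReal ∂μ : ℝ≥0∞) : EReal)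

/-- `φ` is the rotational epi-symmetrization of `ψ`. For `n ≥ 2` it is the member of `Conv_c(ℝⁿ)`
whose Legendre transform is the average of that of `ψ` over `SO(n)`; for `n = 1` it is the
epi-mean of `ψ` and its reflection. -/
structure IsRotEpiSymm {n : ℕ} (ψ φ : Eucl n → EReal) : Prop where
  mem : IsConvC φ
  eq_average : 2 ≤ n → ∀ x, legendre φ x =
    erealIntegral (SO.haar n) (fun θ => legendre ψ (θ⁻¹.act x))
  eq_reflect : n = 1 → φ = epiMul (1 / 2) (infConv ψ (fun x => ψ (-x)))

/-! ### Coercive log-concave functions -/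

/-- The function `e^{-ψ}`. It has values in `[0, ∞)` when `ψ` has values in `(-∞, ∞]`. -/
noncomputable def expNeg {n : ℕ} (ψ : Eucl n → EReal) (x : Eucl n) : ℝ≥0∞ := EReal.exp (-ψ x)

/-- `LC_c(ℝⁿ) = {e^{-ψ} : ψ ∈ Conv_c(ℝⁿ)}`. The values are taken in `[0, ∞]` so that suprema and
upper limits always exist; members of this set only take values in `[0, ∞)`. -/
def LCc (n : ℕ) : Set (Eucl n → ℝ≥0∞) := {f | ∃ ψ : Eucl n → EReal, IsConvC ψ ∧ f = expNeg ψ}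

theorem LCc.ne_top {n : ℕ} (f : LCc n) (x : Eucl n) : f.1 x ≠ ∞ := by
  obtain ⟨f, ψ, hψ, rfl⟩ := f
  simpa [expNeg] using hψ.ne_bot x

/-- The Asplund sum (supremal convolution). -/
noncomputable def asplund {n : ℕ} (f g : Eucl n → ℝ≥0∞) (x : Eucl n) : ℝ≥0∞ :=
  ⨆ y : Eucl n, f y * g (x - y)

/-- The `l`-homothety `x ↦ f(x / l) ^ l`, for `l > 0`. -/
noncomputable def homothety {n : ℕ} (l : ℝ) (f : Eucl n → ℝ≥0∞) (x : Eucl n) : ℝ≥0∞ :=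
  f (l⁻¹ • x) ^ l

/-- Hypo-convergence of a sequence in `LC_c(ℝⁿ)`. -/
def HypoTendsto {n : ℕ} (fs : ℕ → LCc n) (f : LCc n) : Prop :=
  ∀ x : Eucl n,
    (∀ xs : ℕ → Eucl n, Tendsto xs atTop (𝓝 x) →
      limsup (fun j => (fs j).1 (xs j)) atTop ≤ f.1 x) ∧
    (∃ xs : ℕ → Eucl n, Tendsto xs atTop (𝓝 x) ∧
      Tendsto (fun j => (fs j).1 (xs j)) atTop (𝓝 (f.1 x)))

/-- `g` is the rotational hypo-symmetrization of `f = e^{-ψ}`, that is, `g = e^{-ψ_rot}`. -/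
def IsRotHypoSymm {n : ℕ} (f g : LCc n) : Prop :=
  ∃ ψ φ : Eucl n → EReal, IsConvC ψ ∧ f.1 = expNeg ψ ∧ IsRotEpiSymm ψ φ ∧ g.1 = expNeg φ

/-! ### Functionals on `LC_c(ℝⁿ)` -/

/-- The functional takes values in `(0, ∞]` or in `[0, ∞)`: it does not attain both `0` and `∞`. -/
def OneSided {n : ℕ} (G : LCc n → ℝ≥0∞) : Prop := (∀ f, G f ≠ 0) ∨ (∀ f, G f ≠ ∞)

/-- Lower semicontinuity with respect to hypo-convergence. -/
def HypoLSC {n : ℕ} (G : LCc n → ℝ≥0∞) : Prop :=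
  ∀ (fs : ℕ → LCc n) (f : LCc n), HypoTendsto fs f → G f ≤ liminf (fun j => G (fs j)) atTop

/-- Log-convexity with respect to the Asplund sum. (`LC_c(ℝⁿ)` is closed under the two operations,
and `h` ranges over the member `l · f ⋆ (1 - l) · g`.) -/
def IsLogConvexFunctional {n : ℕ} (G : LCc n → ℝ≥0∞) : Prop :=
  ∀ (f g h : LCc n) (l : ℝ), 0 < l → l < 1 →
    h.1 = asplund (homothety l f.1) (homothety (1 - l) g.1) → G h ≤ G f ^ l * G g ^ (1 - l)

/-- Invariance under rotations: `G (f ∘ θ) = G f` for `θ ∈ SO(n)`. -/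
def RotInvariant {n : ℕ} (G : LCc n → ℝ≥0∞) : Prop :=
  ∀ (f g : LCc n) (θ : SO n), (∀ x, g.1 x = f.1 (θ.act x)) → G g = G f

/-- Invariance under the reflection `x ↦ -x`: `G (f ∘ (-1)) = G f`. -/
def ReflInvariant {n : ℕ} (G : LCc n → ℝ≥0∞) : Prop :=
  ∀ f g : LCc n, (∀ x, g.1 x = f.1 (-x)) → G g = G f

/-! ### Closed convex functions and the Legendre transform -/

/-! On the functions ψ, log-convexity says that the sublevel sets of G are closed under epi-means `l
· ψ₁ □ (1 - l) · ψ₂` (`expNeg_epiMean`, `IsLogConvexFunctional.epiMean_le`). For n = 1 this is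
already the claim: `ψ_rot` is the epi-mean with weight 1/2 of ψ and its reflection.

For n ≥ 2 the Legendre transform turns epi-means into convex combinations (`legendre_epiMean`), and
it is injective on closed convex functions by Fenchel-Moreau (`legendre_legendre`). A finite
weighted average of rotated copies of `legendre ψ` is therefore the transform of an iterated
epi-mean of rotated copies of ψ, on which G is at most its value at ψ (`exists_finite_epiMean`). The
Haar average is approached by such finite ones: the identity of `SO n` is a pointwise limit of
simple functions `ss j`, and `rotAvg (ss j)` is a finite average (`rotAvg_simpleFunc`).

To pass to the limit with lower semicontinuity of G, the approximants must hypo-converge. Fatou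
gives a lower bound for the averages along arbitrary convergent points (`eventually_lt_rotAvg`).
Convergence at a fixed point can fail on the boundary of the domain of the limit, but holds at t • y
for t < 1 whenever the limit is finite at y (`tendsto_rotAvg_smul`): transitivity of rotations on
spheres forces `legendre ψ` to be finite on the open ball of radius ‖y‖, where it is continuous.
These two facts, with a uniform bound near 0, suffice for epi-convergence of the conjugates
(`hypoTendsto_expNeg_legendre`); recovery sequences are built from proximal points. -/

theorem le_zero_of_forall_le_mul {a K : ℝ} (h : ∀ t : ℝ, 0 < t → t < 1 → a ≤ t * K) : a ≤ 0 := by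
  have h1 : Tendsto (fun t : ℝ => t * K) (𝓝[>] 0) (𝓝 0) := by
    have : Tendsto (fun t : ℝ => t * K) (𝓝 0) (𝓝 (0 * K)) := tendsto_id.mul_const K
    simpa using this.mono_left nhdsWithin_le_nhds
  refine ge_of_tendsto h1 ?_
  filter_upwards [Ioo_mem_nhdsGT (zero_lt_one (α := ℝ))] with t ht using h t ht.1 ht.2

theorem IsConvexFun.le_of_le {n : ℕ} {u : Eucl n → EReal} (hu : IsConvexFun u) {x y : Eucl n}
    {a b s t : ℝ} (ha : 0 < a) (hb : 0 < b) (hab : a + b = 1) (hx : u x ≤ s) (hy : u y ≤ t) :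
    u (a • x + b • y) ≤ ((a * s + b * t : ℝ) : EReal) := by
  refine (hu x y a b ha hb hab).trans ?_
  rw [EReal.coe_add, EReal.coe_mul, EReal.coe_mul]
  exact add_le_add (mul_le_mul_of_nonneg_left hx (by exact_mod_cast ha.le))
    (mul_le_mul_of_nonneg_left hy (by exact_mod_cast hb.le))

/-- With ⊥ excluded, an infinite value makes the right-hand side of the convexity inequality ⊤, so
only real majorants have to be tested. -/
theorem isConvexFun_of_forall_real {n : ℕ} {u : Eucl n → EReal} (hbot : ∀ x, u x ≠ ⊥)
    (h : ∀ (x y : Eucl n) (a b s t : ℝ), 0 < a → 0 < b → a + b = 1 → u x ≤ s → u y ≤ t →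
      u (a • x + b • y) ≤ ((a * s + b * t : ℝ) : EReal)) : IsConvexFun u := by
  intro x y a b ha hb hab
  have mul_ne_bot : ∀ {c : ℝ} {z : Eucl n}, 0 < c → (c : EReal) * u z ≠ ⊥ := by
    intro c z hc
    rw [EReal.mul_ne_bot]
    refine ⟨Or.inl (EReal.coe_ne_bot _), Or.inr (hbot z), Or.inl (EReal.coe_ne_top _),
      Or.inl (by exact_mod_cast hc.le)⟩
  by_cases hx : u x = ⊤
  · rw [hx, EReal.coe_mul_top_of_pos ha, EReal.top_add_of_ne_bot (mul_ne_bot hb)]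
    exact le_top
  by_cases hy : u y = ⊤
  · rw [hy, EReal.coe_mul_top_of_pos hb, EReal.add_top_of_ne_bot (mul_ne_bot ha)]
    exact le_top
  have hx' := EReal.coe_toReal hx (hbot x)
  have hy' := EReal.coe_toReal hy (hbot y)
  rw [← hx', ← hy', ← EReal.coe_mul, ← EReal.coe_mul, ← EReal.coe_add]
  exact h x y a b _ _ ha hb hab hx'.ge hy'.ge

/-- A real bound on the conjugate at y is an affine minorant of u with slope y. Upper bounds on
conjugates below go through this form, which avoids subtraction in `EReal`. -/
theorem legendre_le_iff {n : ℕ} {u : Eucl n → EReal} {y : Eucl n} {c : ℝ} :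
    legendre u y ≤ c ↔ ∀ x, ((inner ℝ y x - c : ℝ) : EReal) ≤ u x := by
  unfold legendre
  rw [iSup_le_iff]
  refine forall_congr' fun x => ?_
  induction h : u x with
  | bot => simp [-EReal.coe_sub]
  | top => simp
  | coe s =>
    norm_cast
    constructor <;> intro h <;> linarith

theorem le_legendre {n : ℕ} {u : Eucl n → EReal} {x : Eucl n} {s : ℝ} (h : u x ≤ s)
    (y : Eucl n) : ((inner ℝ y x - s : ℝ) : EReal) ≤ legendre u y := by
  refine le_trans ?_ (le_iSup _ x)
  rw [EReal.coe_sub]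
  exact EReal.sub_le_sub le_rfl h

/-- Proper lower semicontinuous convex functions with an affine minorant. -/
structure IsClosedConvex {n : ℕ} (u : Eucl n → EReal) : Prop where
  convex : IsConvexFun u
  proper : ∃ x, u x < ⊤
  lsc : LowerSemicontinuous u
  minorant : ∃ (p : Eucl n) (c : ℝ), ∀ x, ((inner ℝ p x - c : ℝ) : EReal) ≤ u x

namespace IsClosedConvex

variable {n : ℕ} {u : Eucl n → EReal}

theorem ne_bot (hu : IsClosedConvex u) (x : Eucl n) : u x ≠ ⊥ := by
  obtain ⟨p, c, h⟩ := hu.minorant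
  exact ne_bot_of_le_ne_bot (EReal.coe_ne_bot _) (h x)

theorem exists_real (hu : IsClosedConvex u) : ∃ (x : Eucl n) (s : ℝ), u x = s := by
  obtain ⟨x, hx⟩ := hu.proper
  exact ⟨x, _, (EReal.coe_toReal hx.ne (hu.ne_bot x)).symm⟩

/-- The proximal point of `x` and the subgradient that it carries. -/
theorem exists_prox (hu : IsClosedConvex u) (x : Eucl n) {ε : ℝ} (hε : 0 < ε) :
    ∃ (z : Eucl n) (r : ℝ), u z = r ∧
      ∀ w, ((r + inner ℝ (ε⁻¹ • (x - z)) (w - z) : ℝ) : EReal) ≤ u w := by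
  obtain ⟨p, c, hp⟩ := hu.minorant
  obtain ⟨x₁, s₁, hs₁⟩ := hu.exists_real
  set v : Eucl n → EReal := fun w => u w + ((‖w - x‖ ^ 2 / (2 * ε) : ℝ) : EReal) with hv
  have hvlsc : LowerSemicontinuous v := by
    refine LowerSemicontinuous.add' hu.lsc ?_ ?_
    · exact Continuous.lowerSemicontinuous
        (continuous_coe_real_ereal.comp (by fun_prop))
    · intro w
      exact EReal.continuousAt_add (Or.inr (EReal.coe_ne_bot _)) (Or.inr (EReal.coe_ne_top _))
  set K : ℝ := s₁ + ‖x₁ - x‖ ^ 2 / (2 * ε) with hK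
  have hvx₁ : v x₁ = K := by simp [hv, hs₁, hK]
  -- Outside this ball the affine minorant plus the quadratic exceeds K: the first summand lets the
  -- quadratic beat (‖p‖ + 1) * t, the second absorbs the constants, and the third puts x₁ inside
  -- the ball. A minimiser over the ball is then global.
  set ρ : ℝ := 2 * ε * (‖p‖ + 1) + |K - inner ℝ p x + c| + ‖x₁ - x‖ with hρ
  obtain ⟨z, -, hz⟩ := (hvlsc.lowerSemicontinuousOn (Metric.closedBall x ρ)).exists_isMinOn
    (Metric.nonempty_closedBall.mpr (by positivity)) (isCompact_closedBall x ρ)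
  have hmin : ∀ w, v z ≤ v w := by
    have hz1 : v z ≤ K := by
      rw [← hvx₁]
      refine hz ?_
      rw [Metric.mem_closedBall, dist_eq_norm]
      have : 0 ≤ 2 * ε * (‖p‖ + 1) := by positivity
      have := abs_nonneg (K - inner ℝ p x + c)
      linarith
    intro w
    by_cases hw : w ∈ Metric.closedBall x ρ
    · exact hz hw
    refine hz1.trans ?_
    rw [Metric.mem_closedBall, dist_eq_norm, not_le] at hw
    have h1 : ((inner ℝ p w - c + ‖w - x‖ ^ 2 / (2 * ε) : ℝ) : EReal) ≤ v w := by
      rw [EReal.coe_add]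
      exact add_le_add (hp w) le_rfl
    refine le_trans ?_ h1
    norm_cast
    set t := ‖w - x‖
    have h2 : inner ℝ p w = inner ℝ p x + inner ℝ p (w - x) := by
      rw [← inner_add_right]; congr 1; abel
    have h3 : -(‖p‖ * t) ≤ inner ℝ p (w - x) := (abs_le.mp (abs_real_inner_le_norm _ _)).1
    have h4 : (‖p‖ + 1) * t ≤ t ^ 2 / (2 * ε) := by
      rw [le_div_iff₀ (by positivity)]
      have : 2 * ε * (‖p‖ + 1) ≤ t := by
        have := abs_nonneg (K - inner ℝ p x + c)
        have := norm_nonneg (x₁ - x)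
        linarith
      have ht : 0 ≤ t := norm_nonneg _
      nlinarith
    have h5 : |K - inner ℝ p x + c| ≤ t := by
      have : 0 ≤ 2 * ε * (‖p‖ + 1) := by positivity
      have := norm_nonneg (x₁ - x)
      linarith
    have h6 := le_abs_self (K - inner ℝ p x + c)
    rw [h2]
    linarith
  have hztop : u z ≠ ⊤ := by
    intro h
    have := hmin x₁
    rw [hvx₁] at this
    simp only [hv, h, EReal.top_add_coe, top_le_iff] at this
    exact EReal.coe_ne_top _ this
  obtain ⟨r, hr⟩ : ∃ r : ℝ, u z = r := ⟨_, (EReal.coe_toReal hztop (hu.ne_bot z)).symm⟩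
  refine ⟨z, r, hr, fun w => ?_⟩
  by_cases hw : u w = ⊤
  · rw [hw]; exact le_top
  obtain ⟨s, hs⟩ : ∃ s : ℝ, u w = s := ⟨_, (EReal.coe_toReal hw (hu.ne_bot w)).symm⟩
  rw [hs]
  norm_cast
  suffices h : r + inner ℝ (ε⁻¹ • (x - z)) (w - z) - s ≤ 0 by linarith
  -- First-order optimality: compare z with (1 - t) • z + t • w and divide by t. The bound K is the
  -- quadratic term left over, which carries a factor t.
  refine le_zero_of_forall_le_mul (K := ‖w - z‖ ^ 2 / (2 * ε)) fun t ht0 ht1 => ?_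
  have h1 := hu.convex.le_of_le (sub_pos.mpr ht1) ht0 (by ring) hr.le hs.le
  have h2 := (hmin ((1 - t) • z + t • w)).trans
    (add_le_add h1 (le_refl ((‖(1 - t) • z + t • w - x‖ ^ 2 / (2 * ε) : ℝ) : EReal)))
  simp only [hv, hr] at h2
  norm_cast at h2
  have h3 : (1 - t) • z + t • w - x = (z - x) + t • (w - z) := by module
  rw [h3, norm_add_sq_real, inner_smul_right, norm_smul, mul_pow, Real.norm_eq_abs, sq_abs] at h2
  rw [inner_smul_left, ← neg_sub z x, inner_neg_left]
  simp only [conj_trivial]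
  set q : ℝ := inner ℝ (z - x) (w - z)
  have h4 : t * (r + ε⁻¹ * -q - s) ≤ t * (t * (‖w - z‖ ^ 2 / (2 * ε))) := by
    have e : (‖z - x‖ ^ 2 + 2 * (t * q) + t ^ 2 * ‖w - z‖ ^ 2) / (2 * ε) =
      ‖z - x‖ ^ 2 / (2 * ε) + t * (ε⁻¹ * q) + t * (t * (‖w - z‖ ^ 2 / (2 * ε))) := by
      field_simp
    rw [e] at h2
    linarith
  exact le_of_mul_le_mul_left h4 ht0

/-- The Fenchel-Moreau theorem. -/
theorem legendre_legendre (hu : IsClosedConvex u) : legendre (legendre u) = u := by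
  funext x
  refine le_antisymm ?_ ?_
  · by_cases hx : u x = ⊤
    · rw [hx]; exact le_top
    rw [← EReal.coe_toReal hx (hu.ne_bot x), legendre_le_iff]
    intro y
    rw [real_inner_comm]
    exact le_legendre (EReal.le_coe_toReal hx) y
  -- This argument covers u x = ⊤ as well. The subgradient at the proximal point z gives r + ‖x - z‖
  -- ^ 2 / ε as a lower bound for the biconjugate at x. If z is near x, semicontinuity makes r
  -- exceed a; if z is far, the quadratic term does the work.
  by_contra! hlt
  obtain ⟨a, ha1, ha2⟩ := EReal.lt_iff_exists_real_btwn.mp hlt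
  obtain ⟨p, c, hp⟩ := hu.minorant
  obtain ⟨δ, hδ, hball⟩ := Metric.eventually_nhds_iff.mp (hu.lsc x a ha2)
  set B : ℝ := |a - inner ℝ p x + c| + 1 with hB
  have hBpos : 0 < B := by positivity
  -- Chosen so that δ / ε = ‖p‖ + B / δ: once ‖x - z‖ ≥ δ, the quadratic term outweighs both the
  -- decrease of the affine minorant and the gap B up to a.
  set ε : ℝ := δ / (‖p‖ + B / δ) with hεdef
  have hε : 0 < ε := by positivity
  obtain ⟨z, r, hr, hz⟩ := hu.exists_prox x hε
  set y := ε⁻¹ • (x - z) with hy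
  have hval : inner ℝ y (x - z) = ‖x - z‖ ^ 2 / ε := by
    rw [hy, inner_smul_left, real_inner_self_eq_norm_sq]
    simp; ring
  have h1 : legendre u y ≤ ((inner ℝ y x - (r + ‖x - z‖ ^ 2 / ε) : ℝ) : EReal) := by
    rw [legendre_le_iff]
    intro w
    refine le_trans (le_of_eq ?_) (hz w)
    congr 1
    rw [← hval, inner_sub_right, inner_sub_right]
    ring
  have h2 := le_legendre h1 x
  rw [real_inner_comm] at h2
  have h3 := h2.trans_lt ha1
  norm_cast at h3
  have h4 : r + ‖x - z‖ ^ 2 / ε < a := by linarith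
  have h5 : 0 ≤ ‖x - z‖ ^ 2 / ε := by positivity
  rcases lt_or_ge (dist z x) δ with hd | hd
  · have : (a : EReal) < u z := hball hd
    rw [hr] at this
    norm_cast at this
    linarith
  · rw [dist_comm, dist_eq_norm] at hd
    have h6 := hp z
    rw [hr] at h6
    norm_cast at h6
    set t := ‖x - z‖
    have h7 : inner ℝ p z = inner ℝ p x - inner ℝ p (x - z) := by
      rw [inner_sub_right]; ring
    have h8 : inner ℝ p (x - z) ≤ ‖p‖ * t := real_inner_le_norm _ _
    have h9 : δ / ε = ‖p‖ + B / δ := by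
      rw [hεdef]; field_simp
    have h10 : t * (‖p‖ + B / δ) ≤ t ^ 2 / ε := by
      rw [← h9, sq, mul_div_assoc]
      gcongr
    have h11 : B ≤ t * (B / δ) := by
      calc B = δ * (B / δ) := by field_simp
        _ ≤ _ := by gcongr
    have h12 := le_abs_self (a - inner ℝ p x + c)
    linarith

/-- Properness and the affine minorant trade places: a finite value of u yields a minorant of the
conjugate, and the slope of a minorant of u is a point where the conjugate is finite. -/
theorem legendre (hu : IsClosedConvex u) : IsClosedConvex (legendre u) := by
  obtain ⟨x₀, s, hs⟩ := hu.exists_real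
  obtain ⟨p, c, hp⟩ := hu.minorant
  have hmin : ∀ y, ((inner ℝ x₀ y - s : ℝ) : EReal) ≤ _root_.legendre u y := fun y => by
    rw [real_inner_comm]; exact le_legendre hs.le y
  refine ⟨?_, ⟨p, ?_⟩, ?_, x₀, s, hmin⟩
  · refine isConvexFun_of_forall_real
      (fun y => ne_bot_of_le_ne_bot (EReal.coe_ne_bot _) (hmin y)) ?_
    intro x y a b s t ha hb hab hx hy
    rw [legendre_le_iff] at hx hy ⊢
    intro w
    have h1 := hx w
    have h2 := hy w
    by_cases hw : u w = ⊤
    · rw [hw]; exact le_top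
    rw [← EReal.coe_toReal hw (hu.ne_bot w)] at h1 h2 ⊢
    norm_cast at h1 h2 ⊢
    rw [inner_add_left, inner_smul_left, inner_smul_left]
    simp only [conj_trivial]
    have hb' : b = 1 - a := by linarith
    subst hb'
    nlinarith
  · exact (legendre_le_iff.mpr hp).trans_lt (EReal.coe_lt_top _)
  · refine lowerSemicontinuous_iSup fun y => ?_
    simp only [sub_eq_add_neg]
    refine LowerSemicontinuous.add' ?_ (lowerSemicontinuous_const (z := -u y)) ?_
    · exact Continuous.lowerSemicontinuous (continuous_coe_real_ereal.comp (by fun_prop))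
    · intro x
      exact EReal.continuousAt_add (Or.inl (EReal.coe_ne_top _)) (Or.inl (EReal.coe_ne_bot _))

theorem isConvC (hu : IsClosedConvex u) {r C : ℝ} (hr : 0 < r)
    (h : ∀ x, ((r * ‖x‖ - C : ℝ) : EReal) ≤ u x) : IsConvC u where
  ne_bot := hu.ne_bot
  convex := hu.convex
  proper := hu.proper
  lsc := hu.lsc
  coercive := by
    refine tendsto_nhds_top_mono (g := u) (f := fun x => ((r * ‖x‖ - C : ℝ) : EReal)) ?_
      (Eventually.of_forall h)
    rw [EReal.tendsto_coe_nhds_top_iff]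
    exact tendsto_atTop_add_const_right _ (-C)
      ((tendsto_norm_cocompact_atTop).const_mul_atTop hr)

end IsClosedConvex

/-- Coercivity makes u exceed u x₀ by 1 at distance at least ρ from x₀. Convexity along rays from x₀
then forces slope at least 1 / ρ beyond the sphere of radius ρ; inside, semicontinuity gives a lower
bound. -/
theorem IsConvC.exists_growth {n : ℕ} {u : Eucl n → EReal} (hu : IsConvC u) :
    ∃ r C : ℝ, 0 < r ∧ ∀ x, ((r * ‖x‖ - C : ℝ) : EReal) ≤ u x := by
  obtain ⟨x₀, hx₀⟩ := hu.proper
  obtain ⟨c₀, hc₀⟩ : ∃ c : ℝ, u x₀ = c := ⟨_, (EReal.coe_toReal hx₀.ne (hu.ne_bot x₀)).symm⟩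
  have h1 : ∀ᶠ x in cocompact (Eucl n), ((c₀ + 1 : ℝ) : EReal) < u x :=
    hu.coercive.eventually_const_lt (EReal.coe_lt_top _)
  obtain ⟨ρ, hρ, hfar⟩ : ∃ ρ : ℝ, 0 < ρ ∧ ∀ x, ρ ≤ ‖x - x₀‖ → ((c₀ + 1 : ℝ) : EReal) < u x := by
    obtain ⟨K, hK, hKs⟩ := Filter.mem_cocompact.mp h1
    obtain ⟨ρ, hρ⟩ := hK.isBounded.subset_ball x₀
    refine ⟨max ρ 1, by positivity, fun x hx => hKs fun hxK => ?_⟩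
    have := hρ hxK
    rw [Metric.mem_ball, dist_eq_norm] at this
    exact absurd (le_max_left ρ 1) (by linarith)
  obtain ⟨m, hm⟩ : ∃ m : ℝ, ∀ x ∈ Metric.closedBall x₀ ρ, (m : EReal) ≤ u x := by
    obtain ⟨z, -, hz⟩ := (hu.lsc.lowerSemicontinuousOn (Metric.closedBall x₀ ρ)).exists_isMinOn
      (Metric.nonempty_closedBall.mpr hρ.le) (isCompact_closedBall x₀ ρ)
    exact ⟨(u z).toReal, fun x hx => (EReal.coe_toReal_le (hu.ne_bot z)).trans (hz hx)⟩
  refine ⟨ρ⁻¹, |m| + |c₀| + 1 + ρ⁻¹ * ‖x₀‖, by positivity, fun x => ?_⟩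
  have hn : ‖x‖ ≤ ‖x - x₀‖ + ‖x₀‖ := by
    simpa using norm_add_le (x - x₀) x₀
  have hn' : ρ⁻¹ * ‖x‖ ≤ ρ⁻¹ * ‖x - x₀‖ + ρ⁻¹ * ‖x₀‖ := by
    rw [← mul_add]; gcongr
  rcases le_or_gt ‖x - x₀‖ ρ with hx | hx
  · refine le_trans ?_ (hm x (by rwa [Metric.mem_closedBall, dist_eq_norm]))
    norm_cast
    have : ρ⁻¹ * ‖x - x₀‖ ≤ 1 := by
      rw [inv_mul_le_iff₀ hρ]; linarith
    have := neg_abs_le m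
    have := abs_nonneg c₀
    linarith
  · by_cases hxt : u x = ⊤
    · rw [hxt]; exact le_top
    have hs := EReal.coe_toReal hxt (hu.ne_bot x)
    set s := (u x).toReal
    set t := ρ / ‖x - x₀‖ with ht
    have hpos : 0 < ‖x - x₀‖ := hρ.trans hx
    have ht0 : 0 < t := by positivity
    have ht1 : t < 1 := (div_lt_one hpos).mpr hx
    have h2 := hu.convex.le_of_le (sub_pos.mpr ht1) ht0 (by ring) hc₀.le hs.ge
    have h3 : ‖(1 - t) • x₀ + t • x - x₀‖ = ρ := by
      have : (1 - t) • x₀ + t • x - x₀ = t • (x - x₀) := by module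
      rw [this, norm_smul, Real.norm_of_nonneg ht0.le, ht]
      field_simp
    have h4 := (hfar _ h3.ge).trans_le h2
    rw [← hs]
    norm_cast at h4 ⊢
    have h5 : t⁻¹ = ρ⁻¹ * ‖x - x₀‖ := by rw [ht]; field_simp
    have h6 : t⁻¹ * 1 ≤ t⁻¹ * (t * (s - c₀)) :=
      mul_le_mul_of_nonneg_left (by linarith) (by positivity)
    rw [inv_mul_cancel_left₀ ht0.ne', h5] at h6
    have := neg_abs_le c₀
    have := abs_nonneg m
    linarith

theorem IsConvC.isClosedConvex {n : ℕ} {u : Eucl n → EReal} (hu : IsConvC u) :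
    IsClosedConvex u := by
  obtain ⟨r, C, hr, h⟩ := hu.exists_growth
  refine ⟨hu.convex, hu.proper, hu.lsc, 0, C, fun x => le_trans ?_ (h x)⟩
  norm_cast
  rw [inner_zero_left]
  have : 0 ≤ r * ‖x‖ := by positivity
  linarith

/-- Together with `growth_legendre` this is the duality between linear growth at rate r and
boundedness on the ball of radius r. It gives coercivity of the symmetrized functions. -/
theorem legendre_le_of_growth {n : ℕ} {u : Eucl n → EReal} {r C : ℝ}
    (h : ∀ x, ((r * ‖x‖ - C : ℝ) : EReal) ≤ u x) {y : Eucl n} (hy : ‖y‖ ≤ r) :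
    legendre u y ≤ C := by
  rw [legendre_le_iff]
  intro x
  refine le_trans ?_ (h x)
  norm_cast
  have h1 := real_inner_le_norm y x
  have h2 : ‖y‖ * ‖x‖ ≤ r * ‖x‖ := by gcongr
  linarith

theorem growth_legendre {n : ℕ} {u : Eucl n → EReal} {r C : ℝ} (hr : 0 ≤ r)
    (h : ∀ x, ‖x‖ ≤ r → u x ≤ C) (y : Eucl n) :
    ((r * ‖y‖ - C : ℝ) : EReal) ≤ legendre u y := by
  -- The point of the ball maximising the pairing with y; for y = 0 the quotient is 0 by convention
  -- and the point is the origin.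
  have h1 : ‖(r / ‖y‖) • y‖ ≤ r := by
    rw [norm_smul, Real.norm_of_nonneg (by positivity)]
    rcases eq_or_ne ‖y‖ 0 with h0 | h0
    · rw [h0]; simpa using hr
    · rw [div_mul_cancel₀ _ h0]
  refine le_trans (le_of_eq ?_) (le_legendre (h _ h1) y)
  congr 2
  rw [inner_smul_right, real_inner_self_eq_norm_sq]
  rcases eq_or_ne ‖y‖ 0 with h0 | h0
  · rw [h0]; simp
  · field_simp

theorem IsConvC.legendre_injective {n : ℕ} {u v : Eucl n → EReal} (hu : IsConvC u)
    (hv : IsConvC v) (h : legendre u = legendre v) : u = v := by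
  rw [← hu.isClosedConvex.legendre_legendre, h, hv.isClosedConvex.legendre_legendre]

/-! ### Epi-means of two functions -/

/-- The epi-mean `l · ψ₁ □ (1 - l) · ψ₂`. -/
noncomputable def epiMean {n : ℕ} (l : ℝ) (ψ₁ ψ₂ : Eucl n → EReal) (x : Eucl n) : EReal :=
  ⨅ y : Eucl n, ((l : EReal) * ψ₁ (l⁻¹ • y) + ((1 - l : ℝ) : EReal) * ψ₂ ((1 - l)⁻¹ • (x - y)))

theorem EReal.coe_mul_ne_bot {c : ℝ} {a : EReal} (hc : 0 < c) (ha : a ≠ ⊥) :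
    (c : EReal) * a ≠ ⊥ := by
  rw [EReal.mul_ne_bot]
  exact ⟨Or.inl (EReal.coe_ne_bot _), Or.inr ha, Or.inl (EReal.coe_ne_top _),
    Or.inl (by exact_mod_cast hc.le)⟩

theorem EReal.exists_real_of_combination_lt_top {l m : ℝ} (hl : 0 < l) (hm : 0 < m) {a b : EReal}
    (ha : a ≠ ⊥) (hb : b ≠ ⊥) (h : (l : EReal) * a + (m : EReal) * b < ⊤) :
    ∃ s t : ℝ, a = s ∧ b = t := by
  have ha' : a ≠ ⊤ := by
    rintro rfl
    rw [EReal.coe_mul_top_of_pos hl, EReal.top_add_of_ne_bot (EReal.coe_mul_ne_bot hm hb)] at h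
    exact lt_irrefl _ h
  have hb' : b ≠ ⊤ := by
    rintro rfl
    rw [EReal.coe_mul_top_of_pos hm, EReal.add_top_of_ne_bot (EReal.coe_mul_ne_bot hl ha)] at h
    exact lt_irrefl _ h
  exact ⟨_, _, (EReal.coe_toReal ha' ha).symm, (EReal.coe_toReal hb' hb).symm⟩

section EpiMean

variable {n : ℕ} {l : ℝ} {u v : Eucl n → EReal}

theorem epiMean_combination_le (hl : 0 < l) (hl' : l < 1) (a b : Eucl n) :
    epiMean l u v (l • a + (1 - l) • b) ≤ (l : EReal) * u a + ((1 - l : ℝ) : EReal) * v b := by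
  refine (iInf_le _ (l • a)).trans (le_of_eq ?_)
  rw [inv_smul_smul₀ hl.ne', add_sub_cancel_left, inv_smul_smul₀ (sub_pos.mpr hl').ne']

/-- With `epiMean_combination_le` this describes the strict epigraph of the epi-mean as the
combination of the strict epigraphs, so that no attainment of the infimum is needed. -/
theorem exists_of_epiMean_lt (hl : 0 < l) (hl' : l < 1) (hu : ∀ x, u x ≠ ⊥) (hv : ∀ x, v x ≠ ⊥)
    {x : Eucl n} {c : ℝ} (h : epiMean l u v x < c) :
    ∃ (a b : Eucl n) (s t : ℝ), x = l • a + (1 - l) • b ∧ u a = s ∧ v b = t ∧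
      l * s + (1 - l) * t < c := by
  obtain ⟨y, hy⟩ := iInf_lt_iff.mp h
  obtain ⟨s, t, hs, ht⟩ := EReal.exists_real_of_combination_lt_top hl (sub_pos.mpr hl')
    (hu _) (hv _) (hy.trans (EReal.coe_lt_top _))
  refine ⟨_, _, s, t, ?_, hs, ht, ?_⟩
  · rw [smul_inv_smul₀ hl.ne', smul_inv_smul₀ (sub_pos.mpr hl').ne', add_sub_cancel]
  · rw [hs, ht] at hy
    exact_mod_cast hy

theorem epiMean_growth (hl : 0 < l) (hl' : l < 1) (hu : IsConvC u) (hv : IsConvC v) :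
    ∃ r C : ℝ, 0 < r ∧ ∀ x, ((r * ‖x‖ - C : ℝ) : EReal) ≤ epiMean l u v x := by
  obtain ⟨r₁, C₁, hr₁, h₁⟩ := hu.exists_growth
  obtain ⟨r₂, C₂, hr₂, h₂⟩ := hv.exists_growth
  refine ⟨min r₁ r₂, l * C₁ + (1 - l) * C₂, lt_min hr₁ hr₂, fun x => ?_⟩
  by_contra! hlt
  obtain ⟨a, b, s, t, rfl, hs, ht, hst⟩ := exists_of_epiMean_lt hl hl' hu.ne_bot hv.ne_bot hlt
  have ha := h₁ a
  have hb := h₂ b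
  rw [hs] at ha
  rw [ht] at hb
  norm_cast at ha hb
  have hm : 0 < 1 - l := sub_pos.mpr hl'
  have hn : ‖l • a + (1 - l) • b‖ ≤ l * ‖a‖ + (1 - l) * ‖b‖ := by
    refine (norm_add_le _ _).trans (le_of_eq ?_)
    rw [norm_smul, norm_smul, Real.norm_of_nonneg hl.le, Real.norm_of_nonneg hm.le]
  have h3 : min r₁ r₂ * ‖l • a + (1 - l) • b‖ ≤
      l * (r₁ * ‖a‖) + (1 - l) * (r₂ * ‖b‖) := by
    calc _ ≤ min r₁ r₂ * (l * ‖a‖ + (1 - l) * ‖b‖) := by gcongr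
      _ = l * (min r₁ r₂ * ‖a‖) + (1 - l) * (min r₁ r₂ * ‖b‖) := by ring
      _ ≤ _ := by
        gcongr
        · exact min_le_left _ _
        · exact min_le_right _ _
  have h4 := mul_le_mul_of_nonneg_left ha hl.le
  have h5 := mul_le_mul_of_nonneg_left hb hm.le
  linarith

theorem isClosed_setOf_combination_le (hl : 0 < l) (hl' : l < 1) (hu : IsConvC u) (hv : IsConvC v)
    (c : ℝ) : IsClosed {p : Eucl n × Eucl n |
      (l : EReal) * u p.1 + ((1 - l : ℝ) : EReal) * v p.2 ≤ c} := by
  have mul_lsc : ∀ {w : Eucl n → EReal} {m : ℝ}, 0 < m → LowerSemicontinuous w →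
      LowerSemicontinuous fun x => (m : EReal) * w x := by
    intro w m hm hw
    refine Continuous.comp_lowerSemicontinuous ?_ hw ?_
    · refine continuous_iff_continuousAt.mpr fun z => ?_
      exact EReal.Tendsto.const_mul tendsto_id (Or.inl (EReal.coe_ne_bot _))
        (Or.inl (EReal.coe_ne_top _))
    · intro a b hab
      exact mul_le_mul_of_nonneg_left hab (by exact_mod_cast hm.le)
  have hm : 0 < 1 - l := sub_pos.mpr hl'
  have hlsc : LowerSemicontinuous fun p : Eucl n × Eucl n =>
      (l : EReal) * u p.1 + ((1 - l : ℝ) : EReal) * v p.2 := by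
    refine LowerSemicontinuous.add' ((mul_lsc hl hu.lsc).comp continuous_fst)
      ((mul_lsc hm hv.lsc).comp continuous_snd) fun p => ?_
    exact EReal.continuousAt_add (Or.inr (EReal.coe_mul_ne_bot hm (hv.ne_bot _)))
      (Or.inl (EReal.coe_mul_ne_bot hl (hu.ne_bot _)))
  exact hlsc.isClosed_preimage _

theorem isBounded_setOf_combination_le (hl : 0 < l) (hl' : l < 1) (hu : IsConvC u)
    (hv : IsConvC v) (c : ℝ) : Bornology.IsBounded {p : Eucl n × Eucl n |
      (l : EReal) * u p.1 + ((1 - l : ℝ) : EReal) * v p.2 ≤ c} := by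
  obtain ⟨r₁, C₁, hr₁, h₁⟩ := hu.exists_growth
  obtain ⟨r₂, C₂, hr₂, h₂⟩ := hv.exists_growth
  have hm : 0 < 1 - l := sub_pos.mpr hl'
  set B := c + l * C₁ + (1 - l) * C₂
  refine (Metric.isBounded_closedBall (x := (0 : Eucl n × Eucl n))
    (r := max (B / (l * r₁)) (B / ((1 - l) * r₂)))).subset ?_
  rintro ⟨a, b⟩ hab
  simp only [Set.mem_ofPred_eq] at hab
  obtain ⟨s, t, hs, ht⟩ := EReal.exists_real_of_combination_lt_top hl hm
    (hu.ne_bot _) (hv.ne_bot _) (hab.trans_lt (EReal.coe_lt_top _))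
  have ha := h₁ a
  have hb := h₂ b
  rw [hs] at ha hab
  rw [ht] at hb hab
  norm_cast at ha hb hab
  have h4 := mul_le_mul_of_nonneg_left ha hl.le
  have h5 := mul_le_mul_of_nonneg_left hb hm.le
  have h6 : 0 ≤ l * (r₁ * ‖a‖) := by positivity
  have h7 : 0 ≤ (1 - l) * (r₂ * ‖b‖) := by positivity
  rw [mem_closedBall_zero_iff, Prod.norm_mk]
  refine max_le_max ?_ ?_
  · rw [le_div_iff₀ (by positivity)]
    simp only [B]
    linarith
  · rw [le_div_iff₀ (by positivity)]
    simp only [B]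
    linarith

/-- A sublevel set of the infimum is an intersection of images of sublevel sets on the product.
Those are compact, because both functions grow linearly, and so the images are closed. -/
theorem epiMean_lsc (hl : 0 < l) (hl' : l < 1) (hu : IsConvC u) (hv : IsConvC v) :
    LowerSemicontinuous (epiMean l u v) := by
  rw [lowerSemicontinuous_iff_isClosed_preimage]
  intro y
  have key : ∀ c : ℝ, IsClosed ((fun p : Eucl n × Eucl n => l • p.1 + (1 - l) • p.2) ''
      {p | (l : EReal) * u p.1 + ((1 - l : ℝ) : EReal) * v p.2 ≤ c}) := fun c =>
    ((Metric.isCompact_of_isClosed_isBounded (isClosed_setOf_combination_le hl hl' hu hv c)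
      (isBounded_setOf_combination_le hl hl' hu hv c)).image (by fun_prop)).isClosed
  have : epiMean l u v ⁻¹' Set.Iic y = ⋂ (c : ℝ) (_ : y < c),
      ((fun p : Eucl n × Eucl n => l • p.1 + (1 - l) • p.2) ''
        {p | (l : EReal) * u p.1 + ((1 - l : ℝ) : EReal) * v p.2 ≤ c}) := by
    ext x
    simp only [Set.mem_preimage, Set.mem_Iic, Set.mem_iInter]
    constructor
    · intro hx c hc
      obtain ⟨a, b, s, t, rfl, hs, ht, hst⟩ :=
        exists_of_epiMean_lt hl hl' hu.ne_bot hv.ne_bot (hx.trans_lt hc)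
      refine ⟨(a, b), ?_, rfl⟩
      simp only [Set.mem_ofPred_eq, hs, ht]
      exact_mod_cast hst.le
    · intro hx
      rw [← EReal.le_of_forall_lt_iff_le]
      intro c hc
      obtain ⟨⟨a, b⟩, hab, rfl⟩ := hx c hc
      exact (epiMean_combination_le hl hl' a b).trans hab
  rw [this]
  exact isClosed_iInter fun c => isClosed_iInter fun _ => key c

theorem epiMean_isConvC (hl : 0 < l) (hl' : l < 1) (hu : IsConvC u) (hv : IsConvC v) :
    IsConvC (epiMean l u v) := by
  obtain ⟨r, C, hr, hgrowth⟩ := epiMean_growth hl hl' hu hv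
  have hm : 0 < 1 - l := sub_pos.mpr hl'
  have hbot : ∀ x, epiMean l u v x ≠ ⊥ := fun x =>
    ne_bot_of_le_ne_bot (EReal.coe_ne_bot _) (hgrowth x)
  refine IsClosedConvex.isConvC ⟨?_, ?_, epiMean_lsc hl hl' hu hv, 0, C, fun x => ?_⟩ hr hgrowth
  · refine isConvexFun_of_forall_real hbot ?_
    intro x y a b s t ha hb hab hx hy
    rw [← EReal.le_of_forall_lt_iff_le]
    intro c hc
    have hc' : a * s + b * t < c := by exact_mod_cast hc
    set δ := c - (a * s + b * t)
    have hδ : 0 < δ := sub_pos.mpr hc'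
    obtain ⟨x₁, x₂, s₁, s₂, rfl, hs₁, hs₂, hs⟩ := exists_of_epiMean_lt hl hl' hu.ne_bot hv.ne_bot
      (hx.trans_lt (by exact_mod_cast (lt_add_of_pos_right s hδ)))
    obtain ⟨y₁, y₂, t₁, t₂, rfl, ht₁, ht₂, ht⟩ := exists_of_epiMean_lt hl hl' hu.ne_bot hv.ne_bot
      (hy.trans_lt (by exact_mod_cast (lt_add_of_pos_right t hδ)))
    have e : a • (l • x₁ + (1 - l) • x₂) + b • (l • y₁ + (1 - l) • y₂) =
      l • (a • x₁ + b • y₁) + (1 - l) • (a • x₂ + b • y₂) := by module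
    rw [e]
    refine (epiMean_combination_le hl hl' _ _).trans ?_
    have h1 := hu.convex.le_of_le ha hb hab hs₁.le ht₁.le
    have h2 := hv.convex.le_of_le ha hb hab hs₂.le ht₂.le
    refine (add_le_add (mul_le_mul_of_nonneg_left h1 (by exact_mod_cast hl.le))
      (mul_le_mul_of_nonneg_left h2 (by exact_mod_cast hm.le))).trans ?_
    norm_cast
    have h3 := mul_le_mul_of_nonneg_left hs.le ha.le
    have h4 := mul_le_mul_of_nonneg_left ht.le hb.le
    have h5 : a * δ + b * δ = δ := by rw [← add_mul, hab, one_mul]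
    have h6 : δ = c - (a * s + b * t) := rfl
    linarith
  · obtain ⟨a, s, hs⟩ := hu.isClosedConvex.exists_real
    obtain ⟨b, t, ht⟩ := hv.isClosedConvex.exists_real
    refine ⟨_, (epiMean_combination_le hl hl' a b).trans_lt ?_⟩
    rw [hs, ht]
    norm_cast
    exact EReal.coe_lt_top _
  · refine le_trans ?_ (hgrowth x)
    norm_cast
    rw [inner_zero_left]
    have : 0 ≤ r * ‖x‖ := by positivity
    linarith

theorem legendre_epiMean (hl : 0 < l) (hl' : l < 1) (hu : IsConvC u) (hv : IsConvC v)
    (y : Eucl n) : legendre (epiMean l u v) y =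
      (l : EReal) * legendre u y + ((1 - l : ℝ) : EReal) * legendre v y := by
  have hm : 0 < 1 - l := sub_pos.mpr hl'
  have hLu := hu.isClosedConvex.legendre.ne_bot y
  have hLv := hv.isClosedConvex.legendre.ne_bot y
  refine le_antisymm ?_ ?_
  · rw [← EReal.le_of_forall_lt_iff_le]
    intro c hc
    obtain ⟨L₁, L₂, h₁, h₂⟩ := EReal.exists_real_of_combination_lt_top hl hm hLu hLv
      (hc.trans (EReal.coe_lt_top _))
    rw [h₁, h₂] at hc
    norm_cast at hc
    rw [legendre_le_iff]
    intro x
    by_contra! hlt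
    obtain ⟨a, b, s, t, rfl, hs, ht, hst⟩ := exists_of_epiMean_lt hl hl' hu.ne_bot hv.ne_bot hlt
    have ha := legendre_le_iff.mp h₁.le a
    have hb := legendre_le_iff.mp h₂.le b
    rw [hs] at ha
    rw [ht] at hb
    norm_cast at ha hb
    rw [inner_add_right, inner_smul_right, inner_smul_right] at hst
    have h4 := mul_le_mul_of_nonneg_left ha hl.le
    have h5 := mul_le_mul_of_nonneg_left hb hm.le
    linarith
  · rw [← EReal.le_of_forall_lt_iff_le]
    intro c hc
    have key := legendre_le_iff.mp hc.le
    have key' : ∀ a b s t, u a = ((s : ℝ) : EReal) → v b = ((t : ℝ) : EReal) →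
        l * inner ℝ y a + (1 - l) * inner ℝ y b - c ≤ l * s + (1 - l) * t := by
      intro a b s t hs ht
      have := (key _).trans (epiMean_combination_le hl hl' a b)
      rw [hs, ht, inner_add_right, inner_smul_right, inner_smul_right] at this
      exact_mod_cast this
    -- The inequality over pairs (a, b) is now separated. One b with finite value shows that
    -- `legendre u y` is real; then the supremum over a is taken for each b, and finally the one
    -- over b.
    obtain ⟨b, t, ht⟩ := hv.isClosedConvex.exists_real
    have h1 : legendre u y ≤ (((c + (1 - l) * (t - inner ℝ y b)) / l : ℝ) : EReal) := by
      rw [legendre_le_iff]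
      intro a
      by_cases ha : u a = ⊤
      · rw [ha]; exact le_top
      have ha' := EReal.coe_toReal ha (hu.ne_bot a)
      have := key' a b _ t ha'.symm ht
      rw [← ha']
      norm_cast
      rw [sub_le_iff_le_add, ← sub_le_iff_le_add', le_div_iff₀ hl]
      linarith
    obtain ⟨L₁, hL₁⟩ : ∃ L : ℝ, legendre u y = L :=
      ⟨_, (EReal.coe_toReal (h1.trans_lt (EReal.coe_lt_top _)).ne hLu).symm⟩
    have h2 : legendre v y ≤ (((c - l * L₁) / (1 - l) : ℝ) : EReal) := by
      rw [legendre_le_iff]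
      intro b
      by_cases hb : v b = ⊤
      · rw [hb]; exact le_top
      have hb' := EReal.coe_toReal hb (hv.ne_bot b)
      have h3 : legendre u y ≤
          (((c + (1 - l) * ((v b).toReal - inner ℝ y b)) / l : ℝ) : EReal) := by
        rw [legendre_le_iff]
        intro a
        by_cases ha : u a = ⊤
        · rw [ha]; exact le_top
        have ha' := EReal.coe_toReal ha (hu.ne_bot a)
        have := key' a b _ _ ha'.symm hb'.symm
        rw [← ha']
        norm_cast
        rw [sub_le_iff_le_add, ← sub_le_iff_le_add', le_div_iff₀ hl]
        linarith
      rw [hL₁] at h3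
      rw [← hb']
      norm_cast at h3 ⊢
      rw [le_div_iff₀ hl] at h3
      rw [sub_le_iff_le_add, ← sub_le_iff_le_add', le_div_iff₀ hm]
      linarith
    rw [hL₁]
    refine (add_le_add le_rfl (mul_le_mul_of_nonneg_left h2 (by exact_mod_cast hm.le))).trans ?_
    norm_cast
    rw [mul_div_cancel₀ _ hm.ne']
    linarith

/-- The map a ↦ e^{-a} reverses order, so it exchanges infima with suprema, sums with products and
scalar multiples with powers. Excluding ⊥ lets negation distribute over the sum. -/
theorem expNeg_epiMean (hl : 0 < l) (hl' : l < 1) (hu : ∀ x, u x ≠ ⊥) (hv : ∀ x, v x ≠ ⊥) :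
    expNeg (epiMean l u v) =
      asplund (homothety l (expNeg u)) (homothety (1 - l) (expNeg v)) := by
  have hm : 0 < 1 - l := sub_pos.mpr hl'
  funext x
  unfold expNeg epiMean asplund homothety
  have h1 : ∀ f : Eucl n → EReal, EReal.exp (-⨅ y, f y) = ⨆ y, EReal.exp (-f y) := by
    intro f
    have h2 : -(⨅ y, f y) = ⨆ y, -f y := by
      exact congrArg OrderDual.ofDual (EReal.negOrderIso.map_iInf f)
    rw [h2]
    exact EReal.expOrderIso.map_iSup _
  rw [h1]
  refine iSup_congr fun y => ?_
  rw [EReal.neg_add (Or.inl (EReal.coe_mul_ne_bot hl (hu _)))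
    (Or.inr (EReal.coe_mul_ne_bot hm (hv _))), sub_eq_add_neg, EReal.exp_add,
    ← mul_neg, ← mul_neg, mul_comm (l : EReal), mul_comm ((1 - l : ℝ) : EReal),
    EReal.exp_mul, EReal.exp_mul]

end EpiMean

theorem epiMul_infConv_reflect {n : ℕ} (u : Eucl n → EReal) :
    epiMul (1 / 2) (infConv u (fun x => u (-x))) = epiMean (1 / 2) u (fun x => u (-x)) := by
  funext x
  unfold epiMul infConv epiMean
  have h0 : (0 : EReal) ≤ ((1 / 2 : ℝ) : EReal) := by norm_cast; norm_num
  have hhalf : (1 - 1 / 2 : ℝ) = 1 / 2 := by norm_num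
  have distr : ∀ a b : EReal, ((1 / 2 : ℝ) : EReal) * (a + b) =
      ((1 / 2 : ℝ) : EReal) * a + ((1 / 2 : ℝ) : EReal) * b := fun a b =>
    EReal.left_distrib_of_nonneg_of_ne_top h0 (EReal.coe_ne_top _) a b
  rw [hhalf]
  refine le_antisymm (le_iInf fun y => ?_) ?_
  · rw [← distr]
    refine mul_le_mul_of_nonneg_left ((iInf_le _ ((1 / 2 : ℝ)⁻¹ • (x - y))).trans
      (le_of_eq ?_)) h0
    congr 2
    module
  · set I := ⨅ y, (((1 / 2 : ℝ) : EReal) * u ((1 / 2 : ℝ)⁻¹ • y) +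
      ((1 / 2 : ℝ) : EReal) * u (-((1 / 2 : ℝ)⁻¹ • (x - y)))) with hI
    have h12 : ((1 / 2 : ℝ) : EReal) * ((2 : ℝ) : EReal) = 1 := by norm_cast; norm_num
    have h21 : ((2 : ℝ) : EReal) * ((1 / 2 : ℝ) : EReal) = 1 := by norm_cast; norm_num
    have h2 : ((2 : ℝ) : EReal) * I ≤ ⨅ y, (u ((1 / 2 : ℝ)⁻¹ • x - y) + u (-y)) := by
      refine le_iInf fun y => ?_
      rw [← one_mul (_ + _), ← h21, mul_assoc, distr]
      refine mul_le_mul_of_nonneg_left ((iInf_le _ (x - (1 / 2 : ℝ) • y)).trans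
        (le_of_eq ?_)) (EReal.coe_nonneg.mpr zero_le_two)
      congr 3 <;> module
    calc I = ((1 / 2 : ℝ) : EReal) * (((2 : ℝ) : EReal) * I) := by
          rw [← mul_assoc, h12, one_mul]
      _ ≤ _ := mul_le_mul_of_nonneg_left h2 h0

/-! ### The action of rotations -/

namespace SO

variable {n : ℕ}

theorem act_add_smul (θ : SO n) (x y : Eucl n) (a b : ℝ) :
    θ.act (a • x + b • y) = a • θ.act x + b • θ.act y := by
  unfold act
  rw [WithLp.ofLp_add, WithLp.ofLp_smul, WithLp.ofLp_smul, Matrix.mulVec_add, Matrix.mulVec_smul,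
    Matrix.mulVec_smul, WithLp.toLp_add, WithLp.toLp_smul, WithLp.toLp_smul]

theorem mul_act (θ η : SO n) (x : Eucl n) : (θ * η).act x = θ.act (η.act x) := by
  simp [act]

theorem one_act (x : Eucl n) : (1 : SO n).act x = x := by
  simp [act]

theorem inv_act_act (θ : SO n) (x : Eucl n) : θ⁻¹.act (θ.act x) = x := by
  rw [← mul_act, inv_mul_cancel, one_act]

theorem act_inv_act (θ : SO n) (x : Eucl n) : θ.act (θ⁻¹.act x) = x := by
  rw [← mul_act, mul_inv_cancel, one_act]

theorem inner_inv_act (θ : SO n) (x y : Eucl n) :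
    inner ℝ (θ⁻¹.act x) y = inner ℝ x (θ.act y) := by
  simp only [EuclideanSpace.inner_eq_star_dotProduct, act, star_trivial, coe_inv]
  rw [Matrix.mulVec_transpose, dotProduct_comm, ← Matrix.dotProduct_mulVec, dotProduct_comm]

theorem norm_act (θ : SO n) (x : Eucl n) : ‖θ.act x‖ = ‖x‖ := by
  have h : ‖θ.act x‖ ^ 2 = ‖x‖ ^ 2 := by
    rw [← real_inner_self_eq_norm_sq, ← real_inner_self_eq_norm_sq, ← inner_inv_act, inv_act_act]
  exact (pow_left_inj₀ (norm_nonneg _) (norm_nonneg _) two_ne_zero).mp h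

theorem act_zero (θ : SO n) : θ.act (0 : Eucl n) = 0 := by
  rw [← norm_eq_zero, norm_act, norm_zero]

theorem continuous_act : Continuous fun p : SO n × Eucl n => p.1.act p.2 := by
  unfold act
  refine (PiLp.continuous_toLp 2 _).comp ?_
  refine Continuous.matrix_mulVec ?_ ?_
  · exact continuous_subtype_val.comp continuous_fst
  · exact (PiLp.continuous_ofLp 2 _).comp continuous_snd

theorem continuous_inv_act (x : Eucl n) : Continuous fun θ : SO n => θ⁻¹.act x :=
  continuous_act.comp (continuous_inv.prodMk continuous_const)

/-- A linear isometry of determinant one is the action of a rotation. -/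
theorem exists_act_eq (f : Eucl n ≃ₗᵢ[ℝ] Eucl n)
    (hf : LinearMap.det (f.toLinearEquiv : Eucl n →ₗ[ℝ] Eucl n) = 1) :
    ∃ θ : SO n, ∀ x, θ.act x = f x := by
  let b := EuclideanSpace.basisFun (Fin n) ℝ
  let A := LinearMap.toMatrix b.toBasis b.toBasis (f.toLinearEquiv : Eucl n →ₗ[ℝ] Eucl n)
  have hA : A ∈ Matrix.specialOrthogonalGroup (Fin n) ℝ :=
    ⟨f.toMatrix_mem_unitaryGroup b b, (LinearMap.det_toMatrix b.toBasis _).trans hf⟩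
  refine ⟨⟨A, hA⟩, fun x => ?_⟩
  have h := LinearMap.toMatrix_mulVec_repr b.toBasis b.toBasis
    (f.toLinearEquiv : Eucl n →ₗ[ℝ] Eucl n) x
  ext i
  exact congrFun h i

theorem exists_orthogonal (hn : 2 ≤ n) (y : Eucl n) : ∃ w : Eucl n, w ≠ 0 ∧ inner ℝ w y = 0 := by
  have h1 := (Submodule.span ℝ {y}).finrank_add_finrank_orthogonal
  have h2 := finrank_span_le_card (R := ℝ) ({y} : Set (Eucl n))
  rw [finrank_euclideanSpace_fin] at h1
  simp only [Set.toFinset_singleton, Finset.card_singleton] at h2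
  have h3 : (Submodule.span ℝ {y})ᗮ ≠ ⊥ := by
    intro h
    rw [h, finrank_bot] at h1
    omega
  obtain ⟨w, hw, hw0⟩ := Submodule.exists_mem_ne_zero_of_ne_bot h3
  refine ⟨w, hw0, ?_⟩
  rw [real_inner_comm]
  exact Submodule.mem_orthogonal_singleton_iff_inner_right.mp hw

theorem det_reflection_span {v : Eucl n} (hv : v ≠ 0) :
    LinearMap.det ((ℝ ∙ v)ᗮ.reflection.toLinearEquiv : Eucl n →ₗ[ℝ] Eucl n) = -1 := by
  have := Submodule.det_reflection (ℝ ∙ v)ᗮ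
  rw [Submodule.orthogonal_orthogonal, finrank_span_singleton hv, pow_one] at this
  exact this

/-- Rotations act transitively on spheres in dimension at least two. -/
theorem exists_act_eq_of_norm_eq (hn : 2 ≤ n) {x y : Eucl n} (h : ‖x‖ = ‖y‖) :
    ∃ θ : SO n, θ.act x = y := by
  rcases eq_or_ne x y with rfl | hxy
  · exact ⟨1, one_act x⟩
  obtain ⟨w, hw0, hw⟩ := exists_orthogonal hn y
  -- The reflection along x - y sends x to y but has determinant -1. A second reflection, along some
  -- w orthogonal to y, fixes y and corrects the determinant; such a w needs n ≥ 2.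
  obtain ⟨θ, hθ⟩ := exists_act_eq ((ℝ ∙ (x - y))ᗮ.reflection.trans (ℝ ∙ w)ᗮ.reflection) (by
    have h1 := LinearMap.det_comp ((ℝ ∙ w)ᗮ.reflection.toLinearEquiv : Eucl n →ₗ[ℝ] Eucl n)
      ((ℝ ∙ (x - y))ᗮ.reflection.toLinearEquiv : Eucl n →ₗ[ℝ] Eucl n)
    rw [det_reflection_span hw0, det_reflection_span (sub_ne_zero.mpr hxy)] at h1
    rw [show (1 : ℝ) = -1 * -1 by norm_num]
    exact h1)
  refine ⟨θ, ?_⟩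
  rw [hθ, LinearIsometryEquiv.trans_apply, Submodule.reflection_sub h]
  refine Submodule.reflection_mem_subspace_eq_self ?_
  exact Submodule.mem_orthogonal_singleton_iff_inner_right.mpr hw

end SO

theorem legendre_comp_act {n : ℕ} (u : Eucl n → EReal) (θ : SO n) (y : Eucl n) :
    legendre (fun x => u (θ⁻¹.act x)) y = legendre u (θ⁻¹.act y) := by
  unfold legendre
  refine le_antisymm (iSup_le fun x => ?_) (iSup_le fun x => ?_)
  · refine le_trans (le_of_eq ?_) (le_iSup _ (θ⁻¹.act x))
    rw [SO.inner_inv_act, SO.act_inv_act]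
  · refine le_trans (le_of_eq ?_) (le_iSup _ (θ.act x))
    simp only [SO.inner_inv_act, SO.inv_act_act]

theorem IsConvC.comp_act {n : ℕ} {u : Eucl n → EReal} (hu : IsConvC u) (θ : SO n) :
    IsConvC fun x => u (θ.act x) := by
  have hcont : Continuous fun x : Eucl n => θ.act x :=
    SO.continuous_act.comp (continuous_const.prodMk continuous_id)
  obtain ⟨r, C, hr, h⟩ := hu.exists_growth
  obtain ⟨x₀, hx₀⟩ := hu.proper
  refine IsClosedConvex.isConvC ⟨?_, ⟨θ⁻¹.act x₀, ?_⟩, hu.lsc.comp hcont, 0, C, fun x => ?_⟩ (C := C) hr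
    fun x => ?_
  · intro x y a b ha hb hab
    simp only [SO.act_add_smul]
    exact hu.convex _ _ a b ha hb hab
  · rwa [SO.act_inv_act]
  · refine le_trans ?_ (h _)
    norm_cast
    rw [inner_zero_left]
    have : 0 ≤ r * ‖θ.act x‖ := by positivity
    linarith
  · rw [← SO.norm_act θ x]
    exact h _

/-! ### Integrals of extended-real-valued functions -/

/-- The decomposition of a into positive and negative parts, shifted by M so that no subtraction
occurs. -/
theorem EReal.toENNReal_add_ofReal (a : EReal) {M : ℝ} (hM : 0 ≤ M)
    (ha : ((-M : ℝ) : EReal) ≤ a) :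
    a.toENNReal + ENNReal.ofReal M = (a + M).toENNReal + (-a).toENNReal := by
  induction a with
  | bot => simp at ha
  | top => simp
  | coe r =>
    norm_cast at ha ⊢
    simp only [EReal.real_coe_toENNReal]
    rcases le_total 0 r with hr | hr
    · rw [ENNReal.ofReal_of_nonpos (p := -r) (by linarith), add_zero, ENNReal.ofReal_add hr hM]
    · rw [ENNReal.ofReal_of_nonpos hr, zero_add, ← ENNReal.ofReal_add (by linarith) (by linarith)]
      congr 1
      ring

section Integral

variable {α : Type*} [MeasurableSpace α] {μ : Measure α} [IsProbabilityMeasure μ] {u : α → EReal}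

/-- After a shift by M the integrand is nonnegative and one `lintegral` remains, to which
monotonicity, Fatou and dominated convergence apply. -/
theorem erealIntegral_eq (hu : Measurable u) {M : ℝ} (hM : 0 ≤ M)
    (h : ∀ a, ((-M : ℝ) : EReal) ≤ u a) :
    erealIntegral μ u = ((∫⁻ a, (u a + M).toENNReal ∂μ : ℝ≥0∞) : EReal) - (M : EReal) := by
  have h1 : ∫⁻ a, (u a).toENNReal ∂μ + ENNReal.ofReal M =
      ∫⁻ a, (u a + M).toENNReal ∂μ + ∫⁻ a, (-u a).toENNReal ∂μ := by
    have : ∫⁻ _, ENNReal.ofReal M ∂μ = ENNReal.ofReal M := by simp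
    have hneg : Measurable fun a => (-u a).toENNReal := hu.neg.ereal_toENNReal
    rw [← this, ← lintegral_add_right _ measurable_const, ← lintegral_add_right _ hneg]
    exact lintegral_congr fun a => EReal.toENNReal_add_ofReal _ hM (h a)
  have h2 : ∫⁻ a, (-u a).toENNReal ∂μ ≤ ENNReal.ofReal M := by
    calc _ ≤ ∫⁻ _, ENNReal.ofReal M ∂μ := by
          refine lintegral_mono fun a => ?_
          rw [← EReal.real_coe_toENNReal]
          refine EReal.toENNReal_le_toENNReal ?_
          rw [EReal.neg_le, ← EReal.coe_neg]
          exact h a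
      _ = _ := by simp
  unfold erealIntegral
  set P := ∫⁻ a, (u a).toENNReal ∂μ
  set Q := ∫⁻ a, (u a + M).toENNReal ∂μ
  set N := ∫⁻ a, (-u a).toENNReal ∂μ
  have hN : N ≠ ∞ := (h2.trans_lt ENNReal.ofReal_lt_top).ne
  have h3 : (P : EReal) + M = Q + N := by
    have h4 : ((ENNReal.ofReal M : ℝ≥0∞) : EReal) = M := by
      rw [EReal.coe_ennreal_ofReal, max_eq_left hM]
    rw [← h4, ← EReal.coe_ennreal_add, h1, EReal.coe_ennreal_add]
  rw [← EReal.coe_ennreal_toReal hN] at h3 ⊢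
  generalize (P : EReal) = p at h3 ⊢
  generalize (Q : EReal) = q at h3 ⊢
  rw [← EReal.add_sub_cancel_right (a := p) (b := M), h3]
  induction q
  · simp
  · norm_cast
    ring
  · norm_cast

theorem erealIntegral_le (hu : Measurable u) {M C : ℝ} (h : ∀ a, ((-M : ℝ) : EReal) ≤ u a)
    (hC : ∀ a, u a ≤ C) : erealIntegral μ u ≤ C := by
  -- The shift dominates both M and -C, so the shifted integrand and the shifted bound are
  -- nonnegative.
  rw [erealIntegral_eq hu (abs_nonneg (max M (-C))) (fun a => le_trans ?_ (h a))]
  · set K := |max M (-C)|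
    have hK : 0 ≤ C + K := by
      have := le_max_right M (-C)
      have := le_abs_self (max M (-C))
      linarith
    rw [EReal.sub_le_iff_le_add (Or.inl (EReal.coe_ne_bot _)) (Or.inl (EReal.coe_ne_top _)),
      ← EReal.coe_add]
    have : ∫⁻ a, (u a + K).toENNReal ∂μ ≤ ENNReal.ofReal (C + K) := by
      calc _ ≤ ∫⁻ _, ENNReal.ofReal (C + K) ∂μ := by
            refine lintegral_mono fun a => ?_
            rw [← EReal.real_coe_toENNReal, EReal.coe_add]
            exact EReal.toENNReal_le_toENNReal (add_le_add (hC a) le_rfl)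
        _ = _ := by simp
    refine (EReal.coe_ennreal_le_coe_ennreal_iff.mpr this).trans ?_
    rw [EReal.coe_ennreal_ofReal, max_eq_left hK]
  · norm_cast
    have := le_max_left M (-C)
    have := le_abs_self (max M (-C))
    linarith

theorem le_erealIntegral (hu : Measurable u) {g : α → ℝ} {M : ℝ} (hg : Integrable g μ)
    (hM : ∀ a, -M ≤ g a) (h : ∀ a, (g a : EReal) ≤ u a) :
    ((∫ a, g a ∂μ : ℝ) : EReal) ≤ erealIntegral μ u := by
  have hM' : ∀ a, -|M| ≤ g a := fun a => le_trans (neg_le_neg (le_abs_self M)) (hM a)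
  rw [erealIntegral_eq hu (abs_nonneg M) (fun a => le_trans (by exact_mod_cast hM' a) (h a)),
    EReal.le_sub_iff_add_le (Or.inl (EReal.coe_ne_bot _)) (Or.inl (EReal.coe_ne_top _)),
    ← EReal.coe_add]
  have h1 : ∫ a, g a ∂μ + |M| = ∫ a, (g a + |M|) ∂μ := by
    rw [integral_add hg (integrable_const _)]; simp
  rw [h1]
  have h2 : ∀ c : ℝ, (c : EReal) ≤ (ENNReal.ofReal c : ℝ≥0∞) := fun c => by
    rw [EReal.coe_ennreal_ofReal]
    exact_mod_cast le_max_left c 0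
  have h3 : Integrable (fun a => g a + |M|) μ := hg.add (integrable_const _)
  refine (h2 _).trans ?_
  rw [EReal.coe_ennreal_le_coe_ennreal_iff,
    ofReal_integral_eq_lintegral_ofReal h3
      (Eventually.of_forall fun a => by have := hM' a; simp only [Pi.zero_apply]; linarith)]
  refine lintegral_mono fun a => ?_
  rw [← EReal.real_coe_toENNReal, EReal.coe_add]
  exact EReal.toENNReal_le_toENNReal (add_le_add (h a) le_rfl)

end Integral

instance SO.instIsHaarMeasure (n : ℕ) : (SO.haar n).IsHaarMeasure :=
  Measure.isHaarMeasure_haarMeasure _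

theorem SO.tendsto_inv_act {n : ℕ} {ι : Type*} {f : Filter ι} {θs : ι → SO n} {θ : SO n}
    {ys : ι → Eucl n} {y : Eucl n} (hθ : Tendsto θs f (𝓝 θ)) (hy : Tendsto ys f (𝓝 y)) :
    Tendsto (fun j => (θs j)⁻¹.act (ys j)) f (𝓝 (θ⁻¹.act y)) := by
  have hact := (SO.continuous_act (n := n)).tendsto (θ⁻¹, y)
  have hprod : Tendsto (fun j => ((θs j)⁻¹, ys j)) f (𝓝 (θ⁻¹, y)) := hθ.inv.prodMk_nhds hy
  have hcomp := hact.comp hprod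
  exact hcomp

/-! ### Rotational averages -/

/-- The average of `h` over the rotations `s θ`, with `θ` distributed by the Haar measure. -/
noncomputable def rotAvg {n : ℕ} (s : SO n → SO n) (h : Eucl n → EReal) (x : Eucl n) : EReal :=
  erealIntegral (SO.haar n) (fun θ => h ((s θ)⁻¹.act x))

section RotAvg

variable {n : ℕ} {h : Eucl n → EReal} {s : SO n → SO n}

theorem measurable_comp_inv_act {β : Type*} [MeasurableSpace β] {F : Eucl n → β}
    (hF : Measurable F) (hs : Measurable s) (x : Eucl n) :
    Measurable fun θ => F ((s θ)⁻¹.act x) :=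
  hF.comp ((SO.continuous_inv_act x).measurable.comp hs)

/-- Rotations preserve norms, so one constant M serves as the shift for all rotations of all points
of a ball. -/
theorem IsClosedConvex.exists_lower_bound (hh : IsClosedConvex h) (R : ℝ) :
    ∃ M : ℝ, 0 ≤ M ∧ ∀ x, ‖x‖ ≤ R → ((-M : ℝ) : EReal) ≤ h x := by
  obtain ⟨p, c, hp⟩ := hh.minorant
  refine ⟨‖p‖ * |R| + |c|, by positivity, fun x hx => le_trans ?_ (hp x)⟩
  norm_cast
  have h1 := (abs_le.mp (abs_real_inner_le_norm p x)).1
  have h2 : ‖p‖ * ‖x‖ ≤ ‖p‖ * |R| := by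
    gcongr
    exact hx.trans (le_abs_self R)
  have h3 := le_abs_self c
  linarith

theorem rotAvg_eq (hh : IsClosedConvex h) (hs : Measurable s) {R M : ℝ} (hM : 0 ≤ M)
    (hRM : ∀ x, ‖x‖ ≤ R → ((-M : ℝ) : EReal) ≤ h x) {x : Eucl n} (hx : ‖x‖ ≤ R) :
    rotAvg s h x = ((∫⁻ θ, (h ((s θ)⁻¹.act x) + M).toENNReal ∂(SO.haar n) : ℝ≥0∞) : EReal)
      - (M : EReal) :=
  erealIntegral_eq (measurable_comp_inv_act hh.lsc.measurable hs x) hM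
    fun θ => hRM _ (by rwa [SO.norm_act])

theorem rotAvg_le_of_le (hh : IsClosedConvex h) (hs : Measurable s) {r C : ℝ}
    (hb : ∀ x, ‖x‖ ≤ r → h x ≤ C) {x : Eucl n} (hx : ‖x‖ ≤ r) : rotAvg s h x ≤ C := by
  obtain ⟨M, -, hRM⟩ := hh.exists_lower_bound r
  exact erealIntegral_le (measurable_comp_inv_act hh.lsc.measurable hs x)
    (fun θ => hRM _ (by rwa [SO.norm_act])) (fun θ => hb _ (by rwa [SO.norm_act]))

theorem rotAvg_zero (hh : IsClosedConvex h) (hs : Measurable s) {m : ℝ} (h0 : h 0 = m) :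
    rotAvg s h 0 = m := by
  refine le_antisymm ?_ ?_
  · refine erealIntegral_le (M := -m) (measurable_comp_inv_act hh.lsc.measurable hs 0) ?_ ?_ <;>
      (intro θ; simp [SO.act_zero, h0])
  · have := le_erealIntegral (μ := SO.haar n) (g := fun _ => m) (M := -m)
      (measurable_comp_inv_act hh.lsc.measurable hs 0)
      (integrable_const _) (by simp) (fun θ => by rw [SO.act_zero, h0])
    rw [rotAvg]
    simpa using this

theorem lowerSemicontinuous_add_toENNReal (hh : LowerSemicontinuous h) (M : ℝ) :
    LowerSemicontinuous fun x => (h x + M).toENNReal := by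
  refine Continuous.comp_lowerSemicontinuous (g := fun a : EReal => (a + M).toENNReal) ?_ hh ?_
  · refine Continuous.ereal_toENNReal (continuous_iff_continuousAt.mpr fun a => ?_)
    exact (EReal.continuousAt_add (p := (a, (M : EReal))) (Or.inr (EReal.coe_ne_bot _))
      (Or.inr (EReal.coe_ne_top _))).comp
        (f := fun b : EReal => (b, (M : EReal))) (continuousAt_id.prodMk continuousAt_const)
  · intro a b hab
    exact EReal.toENNReal_le_toENNReal (add_le_add hab le_rfl)

/-- Fatou's lemma for rotational averages. -/
theorem eventually_lt_rotAvg (hh : IsClosedConvex h) {ss : ℕ → SO n → SO n}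
    (hs : Measurable s) (hss : ∀ j, Measurable (ss j))
    (hlim : ∀ θ, Tendsto (fun j => ss j θ) atTop (𝓝 (s θ))) {ys : ℕ → Eucl n} {y : Eucl n}
    (hy : Tendsto ys atTop (𝓝 y)) {a : EReal} (ha : a < rotAvg s h y) :
    ∀ᶠ j in atTop, a < rotAvg (ss j) h (ys j) := by
  obtain ⟨R, hR⟩ := (Metric.isBounded_range_of_tendsto ys hy).exists_norm_le
  have hRj : ∀ j, ‖ys j‖ ≤ R := fun j => hR _ ⟨j, rfl⟩
  have hRy : ‖y‖ ≤ R := le_of_tendsto hy.norm (Eventually.of_forall hRj)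
  obtain ⟨M, hM, hRM⟩ := hh.exists_lower_bound R
  set F : Eucl n → ℝ≥0∞ := fun x => (h x + M).toENNReal with hF
  have hFlsc : LowerSemicontinuous F := lowerSemicontinuous_add_toENNReal hh.lsc M
  have h1 : ∫⁻ θ, F ((s θ)⁻¹.act y) ∂(SO.haar n) ≤
      liminf (fun j => ∫⁻ θ, F ((ss j θ)⁻¹.act (ys j)) ∂(SO.haar n)) atTop := by
    refine le_trans (lintegral_mono fun θ => ?_)
      (lintegral_liminf_le fun j => measurable_comp_inv_act hFlsc.measurable (hss j) (ys j))
    have ht := SO.tendsto_inv_act (hlim θ) hy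
    refine le_of_forall_lt_imp_le_of_dense fun c hc => ?_
    exact le_liminf_of_le (by isBoundedDefault)
      ((ht.eventually (hFlsc _ c hc)).mono fun _ => le_of_lt)
  rw [rotAvg_eq hh hs hM hRM hRy] at ha
  have h2 : ∀ j, rotAvg (ss j) h (ys j) = _ := fun j => rotAvg_eq hh (hss j) hM hRM (hRj j)
  simp only [h2]
  have h3 : ∀ b : EReal, a < b - M ↔ a + M < b := fun b =>
    EReal.lt_sub_iff_add_lt (Or.inl (EReal.coe_ne_bot _)) (Or.inl (EReal.coe_ne_top _))
  simp only [h3] at ha ⊢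
  rcases lt_or_ge (a + M) 0 with h0 | h0
  · exact Eventually.of_forall fun j => h0.trans_le (EReal.coe_ennreal_nonneg _)
  · rw [← EReal.coe_toENNReal h0] at ha ⊢
    simp only [EReal.coe_ennreal_lt_coe_ennreal_iff] at ha ⊢
    exact eventually_lt_of_lt_liminf (ha.trans_le h1)

theorem rotAvg_lsc (hh : IsClosedConvex h) (hs : Measurable s) :
    LowerSemicontinuous (rotAvg s h) := by
  intro x a ha
  rw [eventually_iff_seq_eventually]
  intro ys hys
  exact eventually_lt_rotAvg hh hs (fun _ => hs) (fun _ => tendsto_const_nhds) hys ha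

/-- Rotating the argument of an affine minorant rotates its slope p; averaging gives an affine
minorant whose slope is the mean of the rotated slopes. -/
theorem rotAvg_minorant (hh : IsClosedConvex h) (hs : Measurable s) :
    ∃ (p : Eucl n) (c : ℝ), ∀ x, ((inner ℝ p x - c : ℝ) : EReal) ≤ rotAvg s h x := by
  obtain ⟨p, c, hp⟩ := hh.minorant
  have hmeas : Measurable fun θ => (s θ).act p :=
    (SO.continuous_act.comp (continuous_id.prodMk continuous_const)).measurable.comp hs
  have hint : Integrable (fun θ => (s θ).act p) (SO.haar n) :=
    Integrable.of_bound hmeas.aestronglyMeasurable ‖p‖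
      (Eventually.of_forall fun θ => (SO.norm_act _ _).le)
  refine ⟨∫ θ, (s θ).act p ∂(SO.haar n), c, fun x => ?_⟩
  have h1 : Integrable (fun θ => inner ℝ x ((s θ).act p)) (SO.haar n) := hint.const_inner x
  have h2 : inner ℝ (∫ θ, (s θ).act p ∂(SO.haar n)) x - c =
      ∫ θ, (inner ℝ x ((s θ).act p) - c) ∂(SO.haar n) := by
    rw [integral_sub h1 (integrable_const c), integral_inner hint, real_inner_comm]
    simp
  rw [h2]
  refine le_erealIntegral (M := ‖x‖ * ‖p‖ + c) (measurable_comp_inv_act hh.lsc.measurable hs x)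
    (h1.sub (integrable_const c)) (fun θ => ?_) (fun θ => ?_)
  · have := (abs_le.mp (abs_real_inner_le_norm x ((s θ).act p))).1
    rw [SO.norm_act] at this
    linarith
  · rw [← SO.inner_inv_act, real_inner_comm]
    exact hp _

theorem toENNReal_convex_combination_le (hh : IsConvexFun h) {x y : Eucl n} {a b M : ℝ}
    (ha : 0 < a) (hb : 0 < b) (hab : a + b = 1) (hx : ((-M : ℝ) : EReal) ≤ h x)
    (hy : ((-M : ℝ) : EReal) ≤ h y) : (h (a • x + b • y) + M).toENNReal ≤
      ENNReal.ofReal a * (h x + M).toENNReal + ENNReal.ofReal b * (h y + M).toENNReal := by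
  have ha' : (0 : EReal) ≤ a := by exact_mod_cast ha.le
  have hb' : (0 : EReal) ≤ b := by exact_mod_cast hb.le
  have nonneg : ∀ {z : EReal}, ((-M : ℝ) : EReal) ≤ z → 0 ≤ z + M := by
    intro z hz
    calc (0 : EReal) = ((-M : ℝ) : EReal) + M := by norm_cast; simp
      _ ≤ z + M := add_le_add hz le_rfl
  rw [← EReal.real_coe_toENNReal a, ← EReal.real_coe_toENNReal b, ← EReal.toENNReal_mul ha',
    ← EReal.toENNReal_mul hb', ← EReal.toENNReal_add (mul_nonneg ha' (nonneg hx))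
      (mul_nonneg hb' (nonneg hy))]
  refine EReal.toENNReal_le_toENNReal ((add_le_add (hh x y a b ha hb hab) le_rfl).trans ?_)
  rw [EReal.left_distrib_of_nonneg_of_ne_top ha' (EReal.coe_ne_top _),
    EReal.left_distrib_of_nonneg_of_ne_top hb' (EReal.coe_ne_top _), add_add_add_comm]
  refine add_le_add le_rfl (le_of_eq ?_)
  norm_cast
  rw [← add_mul, hab, one_mul]

theorem rotAvg_convex (hh : IsClosedConvex h) (hs : Measurable s) :
    IsConvexFun (rotAvg s h) := by
  obtain ⟨p, c, hp⟩ := rotAvg_minorant hh hs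
  refine isConvexFun_of_forall_real
    (fun x => ne_bot_of_le_ne_bot (EReal.coe_ne_bot _) (hp x)) ?_
  intro x y a b σ τ ha hb hab hx hy
  obtain ⟨M, hM, hRM⟩ := hh.exists_lower_bound (max ‖a • x + b • y‖ (max ‖x‖ ‖y‖))
  have hxR : ‖x‖ ≤ max ‖a • x + b • y‖ (max ‖x‖ ‖y‖) := by simp
  have hyR : ‖y‖ ≤ max ‖a • x + b • y‖ (max ‖x‖ ‖y‖) := by simp
  have hsub : ∀ {b c : EReal}, b - M ≤ c ↔ b ≤ c + M :=
    EReal.sub_le_iff_le_add (Or.inl (EReal.coe_ne_bot _)) (Or.inl (EReal.coe_ne_top _))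
  rw [rotAvg_eq hh hs hM hRM hxR, hsub] at hx
  rw [rotAvg_eq hh hs hM hRM hyR, hsub] at hy
  rw [rotAvg_eq hh hs hM hRM (le_max_left _ _), hsub]
  have hmeas : ∀ z, Measurable fun θ => (h ((s θ)⁻¹.act z) + M).toENNReal := fun z =>
    measurable_comp_inv_act (lowerSemicontinuous_add_toENNReal hh.lsc M).measurable hs z
  have h1 : ∫⁻ θ, (h ((s θ)⁻¹.act (a • x + b • y)) + M).toENNReal ∂(SO.haar n) ≤
      ENNReal.ofReal a * ∫⁻ θ, (h ((s θ)⁻¹.act x) + M).toENNReal ∂(SO.haar n) +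
      ENNReal.ofReal b * ∫⁻ θ, (h ((s θ)⁻¹.act y) + M).toENNReal ∂(SO.haar n) := by
    rw [← lintegral_const_mul _ (hmeas x), ← lintegral_const_mul _ (hmeas y),
      ← lintegral_add_left ((hmeas x).const_mul _)]
    refine lintegral_mono fun θ => ?_
    rw [SO.act_add_smul]
    exact toENNReal_convex_combination_le hh.convex ha hb hab
      (hRM _ (by rwa [SO.norm_act])) (hRM _ (by rwa [SO.norm_act]))
  have ofReal_coe : ∀ {a : ℝ}, 0 < a → ((ENNReal.ofReal a : ℝ≥0∞) : EReal) = a := by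
    intro a ha
    rw [EReal.coe_ennreal_ofReal, max_eq_left ha.le]
  refine (EReal.coe_ennreal_le_coe_ennreal_iff.mpr h1).trans ?_
  rw [EReal.coe_ennreal_add, EReal.coe_ennreal_mul, EReal.coe_ennreal_mul, ofReal_coe ha,
    ofReal_coe hb]
  refine (add_le_add (mul_le_mul_of_nonneg_left hx (by exact_mod_cast ha.le))
    (mul_le_mul_of_nonneg_left hy (by exact_mod_cast hb.le))).trans (le_of_eq ?_)
  norm_cast
  have hb' : b = 1 - a := by linarith
  subst hb'
  ring

theorem IsClosedConvex.rotAvg (hh : IsClosedConvex h) (hs : Measurable s) {m : ℝ}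
    (h0 : h 0 = m) : IsClosedConvex (rotAvg s h) where
  convex := rotAvg_convex hh hs
  proper := ⟨0, by rw [rotAvg_zero hh hs h0]; exact EReal.coe_lt_top _⟩
  lsc := rotAvg_lsc hh hs
  minorant := rotAvg_minorant hh hs

end RotAvg

/-! ### Domain of the Haar average and convergence of the approximating averages -/

section RotAvgLimit

variable {n : ℕ} {h : Eucl n → EReal}

/-- If the rotational average of `h` is finite at `y`, then `h` is finite in the open ball of
radius `‖y‖`. -/
theorem lt_top_of_rotAvg_lt_top (hn : 2 ≤ n) (hh : IsClosedConvex h) {r C : ℝ} (hr : 0 < r)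
    (hb : ∀ x, ‖x‖ ≤ r → h x ≤ C) {y : Eucl n} (hy : rotAvg id h y < ⊤) {z : Eucl n}
    (hz : ‖z‖ < ‖y‖) : h z < ⊤ := by
  by_contra hzt
  set D : Set (Eucl n) := {x | h x < ⊤} with hD
  have hDconv : Convex ℝ D := by
    rw [convex_iff_forall_pos]
    intro x hx w hw a b ha hb hab
    have := hh.convex.le_of_le ha hb hab (EReal.le_coe_toReal (ne_of_lt hx))
      (EReal.le_coe_toReal (ne_of_lt hw))
    exact this.trans_lt (EReal.coe_lt_top _)
  have h0 : (0 : Eucl n) ∈ interior D := by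
    rw [mem_interior_iff_mem_nhds]
    refine mem_of_superset (Metric.closedBall_mem_nhds 0 hr) fun x hx => ?_
    exact (hb x (mem_closedBall_zero_iff.mp hx)).trans_lt (EReal.coe_lt_top _)
  have hzC : z ∉ interior D := fun hzC => hzt (show z ∈ D from interior_subset hzC)
  -- If h is infinite at z, a hyperplane through z keeps the interior of the domain strictly on one
  -- side, hence the domain itself weakly.
  obtain ⟨f, hf⟩ := geometric_hahn_banach_open_point hDconv.interior isOpen_interior hzC
  have hfD : ∀ x ∈ D, f x ≤ f z := by
    intro x hx
    have hx' : x ∈ closure (interior D) := by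
      rw [hDconv.closure_interior_eq_closure_of_nonempty_interior ⟨0, h0⟩]
      exact subset_closure hx
    exact closure_minimal (fun w hw => (hf w hw).le)
      (isClosed_le f.continuous continuous_const) hx'
  set v : Eucl n := (InnerProductSpace.toDual ℝ (Eucl n)).symm f with hv
  have hfv : ∀ x, f x = inner ℝ v x := fun x => by
    rw [hv, InnerProductSpace.toDual_symm_apply]
  have hfz : 0 < f z := by simpa using hf 0 h0
  have hv0 : 0 < ‖v‖ := by
    rw [norm_pos_iff]
    intro h
    rw [hfv, h, inner_zero_left] at hfz
    exact lt_irrefl _ hfz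
  -- The point of the sphere of radius ‖y‖ at which f is largest. As ‖z‖ < ‖y‖, it lies strictly
  -- beyond the hyperplane.
  set w : Eucl n := (‖y‖ / ‖v‖) • v with hw
  have hwn : ‖w‖ = ‖y‖ := by
    rw [hw, norm_smul, Real.norm_of_nonneg (by positivity)]
    field_simp
  have hwf : f z < f w := by
    have h1 : f w = ‖v‖ * ‖y‖ := by
      rw [hfv, hw, inner_smul_right, real_inner_self_eq_norm_sq]
      field_simp
    have h2 : f z ≤ ‖v‖ * ‖z‖ := by rw [hfv]; exact real_inner_le_norm _ _
    rw [h1]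
    exact h2.trans_lt (by gcongr)
  obtain ⟨θ₀, hθ₀⟩ := SO.exists_act_eq_of_norm_eq hn hwn.symm
  -- Rotations carrying y beyond the hyperplane form an open set, nonempty by transitivity, hence of
  -- positive Haar measure. The integrand is ⊤ on it.
  set U : Set (SO n) := {θ | f z < f (θ⁻¹.act y)} with hU
  have hUo : IsOpen U :=
    isOpen_lt continuous_const (f.continuous.comp (SO.continuous_inv_act y))
  have hUpos : 0 < SO.haar n U :=
    hUo.measure_pos _ ⟨θ₀⁻¹, by simp only [hU, Set.mem_ofPred_eq, inv_inv, hθ₀]; exact hwf⟩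
  obtain ⟨M, hM, hRM⟩ := hh.exists_lower_bound ‖y‖
  rw [rotAvg_eq hh measurable_id hM hRM le_rfl] at hy
  have htop : ∫⁻ θ, (h ((id θ)⁻¹.act y) + M).toENNReal ∂(SO.haar n) = ⊤ := by
    refine lintegral_eq_top_of_measure_eq_top_ne_zero ?_ ?_
    · exact (measurable_comp_inv_act (lowerSemicontinuous_add_toENNReal hh.lsc M).measurable
        measurable_id y).aemeasurable
    · refine (hUpos.trans_le (measure_mono fun θ hθ => ?_)).ne'
      have hnD : ¬ h (θ⁻¹.act y) < ⊤ := fun hlt => absurd (hfD _ hlt) (not_le.mpr hθ)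
      rw [not_lt, top_le_iff] at hnD
      simp [hnD]
  rw [htop] at hy
  simp at hy

theorem continuousOn_ball_of_lt_top (hh : IsClosedConvex h) {ρ : ℝ}
    (hfin : ∀ z, ‖z‖ < ρ → h z < ⊤) :
    ContinuousOn (fun z => (h z).toReal) (Metric.ball 0 ρ) := by
  have hcoe : ∀ z ∈ Metric.ball (0 : Eucl n) ρ, ((h z).toReal : EReal) = h z := fun z hz =>
    EReal.coe_toReal (hfin z (mem_ball_zero_iff.mp hz)).ne (hh.ne_bot z)
  refine ConvexOn.continuousOn Metric.isOpen_ball ?_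
  rw [convexOn_iff_forall_pos]
  refine ⟨convex_ball 0 ρ, fun x hx y hy a b ha hb hab => ?_⟩
  have hxy := convex_ball (0 : Eucl n) ρ hx hy ha.le hb.le hab
  have := hh.convex.le_of_le ha hb hab (hcoe x hx).ge (hcoe y hy).ge
  rw [← hcoe _ hxy] at this
  exact_mod_cast this

/-- A convex function finite on an open ball is continuous there, hence bounded on the sphere
through y, and dominated convergence applies. -/
theorem tendsto_rotAvg_of_lt (hh : IsClosedConvex h) {ss : ℕ → SO n → SO n}
    (hss : ∀ j, Measurable (ss j)) (hlim : ∀ θ, Tendsto (fun j => ss j θ) atTop (𝓝 θ)) {ρ : ℝ}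
    (hfin : ∀ z, ‖z‖ < ρ → h z < ⊤) {y : Eucl n} (hy : ‖y‖ < ρ) :
    Tendsto (fun j => rotAvg (ss j) h y) atTop (𝓝 (rotAvg id h y)) := by
  have hcont := continuousOn_ball_of_lt_top hh hfin
  have hcoe : ∀ z, ‖z‖ < ρ → ((h z).toReal : EReal) = h z := fun z hz =>
    EReal.coe_toReal (hfin z hz).ne (hh.ne_bot z)
  obtain ⟨B, hB⟩ := ((isCompact_sphere (0 : Eucl n) ‖y‖).image_of_continuousOn
    (hcont.mono fun z hz => by
      rw [mem_sphere_zero_iff_norm] at hz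
      rwa [mem_ball_zero_iff, hz])).bddAbove
  have hB' : ∀ z, ‖z‖ = ‖y‖ → h z ≤ B := fun z hz => by
    rw [← hcoe z (hz ▸ hy)]
    exact_mod_cast hB ⟨z, mem_sphere_zero_iff_norm.mpr hz, rfl⟩
  obtain ⟨M, hM, hRM⟩ := hh.exists_lower_bound ‖y‖
  simp only [fun j => rotAvg_eq hh (hss j) hM hRM (le_refl ‖y‖),
    rotAvg_eq hh measurable_id hM hRM (le_refl ‖y‖)]
  have hmeasF := (lowerSemicontinuous_add_toENNReal hh.lsc M).measurable
  have hlint : Tendsto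
      (fun j => ∫⁻ θ, (h ((ss j θ)⁻¹.act y) + M).toENNReal ∂(SO.haar n)) atTop
      (𝓝 (∫⁻ θ, (h ((id θ)⁻¹.act y) + M).toENNReal ∂(SO.haar n))) := by
    refine tendsto_lintegral_of_dominated_convergence (fun _ => ENNReal.ofReal (B + M))
      (fun j => measurable_comp_inv_act hmeasF (hss j) y)
      (fun j => Eventually.of_forall fun θ => ?_) (by simp)
      (Eventually.of_forall fun θ => ?_)
    · rw [← EReal.real_coe_toENNReal, EReal.coe_add]
      exact EReal.toENNReal_le_toENNReal (add_le_add (hB' _ (SO.norm_act _ _)) le_rfl)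
    · have h1 : Tendsto (fun j => (ss j θ)⁻¹.act y) atTop (𝓝 (θ⁻¹.act y)) :=
        SO.tendsto_inv_act (hlim θ) tendsto_const_nhds
      have h2 : θ⁻¹.act y ∈ Metric.ball (0 : Eucl n) ρ := by
        rwa [mem_ball_zero_iff, SO.norm_act]
      have h3 := (hcont.continuousAt (Metric.isOpen_ball.mem_nhds h2)).tendsto.comp h1
      have h4 : ∀ η : SO n, (h (η⁻¹.act y) + M).toENNReal =
          ENNReal.ofReal ((h (η⁻¹.act y)).toReal + M) := fun η => by
        rw [← hcoe (η⁻¹.act y) (by rwa [SO.norm_act]), EReal.toReal_coe, ← EReal.coe_add,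
          EReal.real_coe_toENNReal]
      simp only [h4, id]
      exact ENNReal.tendsto_ofReal (h3.add_const M)
  have hsub : ContinuousAt (fun a : EReal => a - M)
      ((∫⁻ θ, (h ((id θ)⁻¹.act y) + M).toENNReal ∂(SO.haar n) : ℝ≥0∞) : EReal) :=
    ContinuousAt.comp (g := fun p : EReal × EReal => p.1 + p.2)
      (f := fun b : EReal => (b, -(M : EReal)))
      (EReal.continuousAt_add (Or.inr (by simp)) (Or.inr (by simp)))
      (continuousAt_id.prodMk continuousAt_const)
  exact hsub.tendsto.comp ((continuous_coe_ennreal_ereal.tendsto _).comp hlint)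

/-- Convergence of the rotational averages strictly inside the domain of the limit. -/
theorem tendsto_rotAvg_smul (hn : 2 ≤ n) (hh : IsClosedConvex h) {r C : ℝ} (hr : 0 < r)
    (hb : ∀ x, ‖x‖ ≤ r → h x ≤ C) {ss : ℕ → SO n → SO n} (hss : ∀ j, Measurable (ss j))
    (hlim : ∀ θ, Tendsto (fun j => ss j θ) atTop (𝓝 θ)) {y : Eucl n}
    (hy : rotAvg id h y < ⊤) {t : ℝ} (ht0 : 0 ≤ t) (ht1 : t < 1) :
    Tendsto (fun j => rotAvg (ss j) h (t • y)) atTop (𝓝 (rotAvg id h (t • y))) := by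
  rcases eq_or_ne y 0 with rfl | hy0
  -- At y = 0 the ball of radius ‖y‖ is empty, so the ball on which h is bounded by C replaces it.
  · have hfin : ∀ z : Eucl n, ‖z‖ < r → h z < ⊤ := fun z hz =>
      (hb z hz.le).trans_lt (EReal.coe_lt_top _)
    exact tendsto_rotAvg_of_lt hh hss hlim hfin (by simpa using hr)
  · refine tendsto_rotAvg_of_lt hh hss hlim (ρ := ‖y‖)
      (fun z hz => lt_top_of_rotAvg_lt_top hn hh hr hb hy hz) ?_
    rw [norm_smul, Real.norm_of_nonneg ht0]
    exact mul_lt_of_lt_one_left (norm_pos_iff.mpr hy0) ht1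

end RotAvgLimit

/-! ### Finite epi-means of rotations -/

theorem SO.exists_simpleFunc_tendsto (n : ℕ) : ∃ ss : ℕ → SimpleFunc (SO n) (SO n),
    ∀ θ, Tendsto (fun j => ss j θ) atTop (𝓝 θ) := by
  have : TopologicalSpace.PseudoMetrizableSpace (Matrix (Fin n) (Fin n) ℝ) :=
    inferInstanceAs (TopologicalSpace.PseudoMetrizableSpace (Fin n → Fin n → ℝ))
  have : SecondCountableTopology (Matrix (Fin n) (Fin n) ℝ) :=
    inferInstanceAs (SecondCountableTopology (Fin n → Fin n → ℝ))
  have : TopologicalSpace.PseudoMetrizableSpace (SO n) :=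
    IsInducing.subtypeVal.pseudoMetrizableSpace
  have : SecondCountableTopology (SO n) := IsInducing.subtypeVal.secondCountableTopology
  exact stronglyMeasurable_id (α := SO n)

theorem EReal.coe_mul_sum {ι : Type*} {c : ℝ} (hc : 0 ≤ c) (T : Finset ι) (f : ι → EReal) :
    (c : EReal) * ∑ i ∈ T, f i = ∑ i ∈ T, (c : EReal) * f i := by
  induction T using Finset.cons_induction with
  | empty => simp
  | cons a T ha ih =>
    rw [Finset.sum_cons, Finset.sum_cons, EReal.left_distrib_of_nonneg_of_ne_top
      (by exact_mod_cast hc) (EReal.coe_ne_top _), ih]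

theorem EReal.coe_sum_add {ι : Type*} {M : ℝ} {T : Finset ι} {w : ι → ℝ} (hw : ∀ i ∈ T, 0 ≤ w i)
    {F : ι → EReal} (hF : ∀ i, ((-M : ℝ) : EReal) ≤ F i) :
    ((∑ i ∈ T, (F i + M).toENNReal * ENNReal.ofReal (w i) : ℝ≥0∞) : EReal) =
      ∑ i ∈ T, (w i : EReal) * F i + (((∑ i ∈ T, w i) * M : ℝ) : EReal) := by
  induction T using Finset.cons_induction with
  | empty => simp
  | cons a T ha ih =>
    have hwa : 0 ≤ w a := hw a (Finset.mem_cons_self a T)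
    have hFa : 0 ≤ F a + M := by
      calc (0 : EReal) = ((-M : ℝ) : EReal) + M := by norm_cast; simp
        _ ≤ F a + M := add_le_add (hF a) le_rfl
    rw [Finset.sum_cons, Finset.sum_cons, Finset.sum_cons, EReal.coe_ennreal_add,
      ih fun i hi => hw i (Finset.mem_cons_of_mem hi), EReal.coe_ennreal_mul,
      EReal.coe_toENNReal hFa, EReal.coe_ennreal_ofReal, max_eq_left hwa, mul_comm (F a + M),
      EReal.left_distrib_of_nonneg_of_ne_top (by exact_mod_cast hwa) (EReal.coe_ne_top _),
      add_add_add_comm]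
    congr 1
    norm_cast
    ring

theorem rotAvg_simpleFunc {n : ℕ} {h : Eucl n → EReal} (hh : IsClosedConvex h)
    (s : SimpleFunc (SO n) (SO n)) : ∃ (T : Finset (SO n)) (w : SO n → ℝ), T.Nonempty ∧
      (∀ η ∈ T, 0 < w η) ∧ ∑ η ∈ T, w η = 1 ∧
      ∀ x, rotAvg s h x = ∑ η ∈ T, (w η : EReal) * h (η⁻¹.act x) := by
  classical
  set w : SO n → ℝ := fun η => (SO.haar n (s ⁻¹' {η})).toReal with hw
  -- Weights are the Haar measures of the fibres. Null fibres are dropped because epi-means need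
  -- strictly positive weights.
  set T := s.range.filter fun η => SO.haar n (s ⁻¹' {η}) ≠ 0 with hT
  have hfin : ∀ η, SO.haar n (s ⁻¹' {η}) ≠ ∞ := fun η => measure_ne_top _ _
  have hof : ∀ η, ENNReal.ofReal (w η) = SO.haar n (s ⁻¹' {η}) := fun η =>
    ENNReal.ofReal_toReal (hfin η)
  have hsum : ∑ η ∈ T, w η = 1 := by
    have h1 : ∑ η ∈ s.range, SO.haar n (s ⁻¹' {η}) = 1 := by
      rw [s.sum_range_measure_preimage_singleton, measure_univ]
    rw [hT, Finset.sum_filter_of_ne, ← ENNReal.toReal_sum fun η _ => hfin η, h1, ENNReal.toReal_one]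
    intro η _ hη h0
    exact hη (by simp [hw, h0])
  refine ⟨T, w, ?_, ?_, hsum, fun x => ?_⟩
  · rw [Finset.nonempty_iff_ne_empty]
    intro h0
    rw [h0] at hsum
    simp at hsum
  · intro η hη
    exact ENNReal.toReal_pos (Finset.mem_filter.mp hη).2 (hfin η)
  · obtain ⟨M, hM, hRM⟩ := hh.exists_lower_bound ‖x‖
    rw [rotAvg_eq hh s.measurable hM hRM le_rfl]
    set F : SO n → EReal := fun η => h (η⁻¹.act x) with hF
    have h1 : ∫⁻ θ, (h ((s θ)⁻¹.act x) + M).toENNReal ∂(SO.haar n) =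
        ∑ η ∈ T, (F η + M).toENNReal * ENNReal.ofReal (w η) := by
      have h2 := SimpleFunc.lintegral_eq_lintegral (s.map fun η => (F η + M).toENNReal) (SO.haar n)
      rw [SimpleFunc.map_lintegral] at h2
      refine h2.trans ?_
      rw [hT, Finset.sum_filter_of_ne]
      · simp only [hof]
      · intro η _ hη h0
        exact hη (by rw [hof, h0, mul_zero])
    rw [h1, EReal.coe_sum_add (fun η hη => ENNReal.toReal_nonneg)
      (fun η => hRM _ (SO.norm_act _ _).le), hsum, one_mul, EReal.add_sub_cancel_right]

theorem mem_LCc_of_isConvC {n : ℕ} {u : Eucl n → EReal} (hu : IsConvC u) : expNeg u ∈ LCc n :=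
  ⟨u, hu, rfl⟩

/-- A common bound c suffices, since c ^ l * c ^ (1 - l) = c holds throughout [0, ∞], including at 0
and ∞. -/
theorem IsLogConvexFunctional.epiMean_le {n : ℕ} {G : LCc n → ℝ≥0∞} (hG : IsLogConvexFunctional G)
    {u v : Eucl n → EReal} (hu : IsConvC u) (hv : IsConvC v) {l : ℝ} (hl : 0 < l) (hl' : l < 1)
    {c : ℝ≥0∞} (hGu : G ⟨_, mem_LCc_of_isConvC hu⟩ ≤ c) (hGv : G ⟨_, mem_LCc_of_isConvC hv⟩ ≤ c) :
    G ⟨_, mem_LCc_of_isConvC (epiMean_isConvC hl hl' hu hv)⟩ ≤ c := by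
  refine (hG ⟨_, mem_LCc_of_isConvC hu⟩ ⟨_, mem_LCc_of_isConvC hv⟩ _ l hl hl'
    (expNeg_epiMean hl hl' hu.ne_bot hv.ne_bot)).trans ?_
  have hm : 0 ≤ 1 - l := (sub_pos.mpr hl').le
  calc _ ≤ c ^ l * c ^ (1 - l) := mul_le_mul' (ENNReal.rpow_le_rpow hGu hl.le)
        (ENNReal.rpow_le_rpow hGv hm)
    _ = c := by
      rw [← ENNReal.rpow_add_of_nonneg _ _ hl.le hm, add_sub_cancel, ENNReal.rpow_one]

/-- Induction on the set of rotations: one rotation is split off and the remaining weights are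
divided by 1 - w a. The weights are quantified after the colon because they change in the induction.
-/
theorem exists_finite_epiMean {n : ℕ} {G : LCc n → ℝ≥0∞} (hG : IsLogConvexFunctional G)
    (hrot : RotInvariant G) {u : Eucl n → EReal} (hu : IsConvC u) {T : Finset (SO n)}
    (hT : T.Nonempty) : ∀ w : SO n → ℝ, (∀ η ∈ T, 0 < w η) → ∑ η ∈ T, w η = 1 →
    ∃ (ψ : Eucl n → EReal) (hψ : IsConvC ψ),
      (∀ x, legendre ψ x = ∑ η ∈ T, (w η : EReal) * legendre u (η⁻¹.act x)) ∧
      G ⟨_, mem_LCc_of_isConvC hψ⟩ ≤ G ⟨_, mem_LCc_of_isConvC hu⟩ := by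
  have rot : ∀ η : SO n, G ⟨_, mem_LCc_of_isConvC (hu.comp_act η⁻¹)⟩ ≤
      G ⟨_, mem_LCc_of_isConvC hu⟩ := fun η => (hrot _ _ η⁻¹ fun _ => rfl).le
  induction hT using Finset.Nonempty.cons_induction with
  | singleton a =>
    intro w _ hw
    rw [Finset.sum_singleton] at hw
    refine ⟨_, hu.comp_act a⁻¹, fun x => ?_, rot a⟩
    rw [Finset.sum_singleton, hw, EReal.coe_one, one_mul, legendre_comp_act]
  | cons a T ha hT ih =>
    intro w hpos hw
    rw [Finset.sum_cons] at hw
    have hl : 0 < w a := hpos a (Finset.mem_cons_self a T)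
    have hTpos : ∀ η ∈ T, 0 < w η := fun η hη => hpos η (Finset.mem_cons_of_mem hη)
    have hm : 0 < 1 - w a := by
      rw [← hw, add_sub_cancel_left]
      exact Finset.sum_pos hTpos hT
    have hl' : w a < 1 := sub_pos.mp hm
    obtain ⟨ψ, hψ, hL, hGψ⟩ := ih (fun η => w η / (1 - w a))
      (fun η hη => div_pos (hTpos η hη) hm) (by
        rw [← Finset.sum_div, div_eq_one_iff_eq hm.ne']
        linarith)
    refine ⟨_, epiMean_isConvC hl hl' (hu.comp_act a⁻¹) hψ, fun x => ?_,
      hG.epiMean_le (hu.comp_act a⁻¹) hψ hl hl' (rot a) hGψ⟩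
    rw [legendre_epiMean hl hl' (hu.comp_act a⁻¹) hψ, legendre_comp_act, hL,
      EReal.coe_mul_sum hm.le, Finset.sum_cons]
    congr 1
    refine Finset.sum_congr rfl fun η _ => ?_
    rw [← mul_assoc, ← EReal.coe_mul, mul_div_cancel₀ _ hm.ne']

/-! ### Epi-convergence of Legendre transforms -/

/-- Diagonal selection: z j solves the problem for the largest solvable level k ≤ j, and that level
eventually passes any given k. -/
theorem exists_seq_of_eventually_exists {α : Type*} [Nonempty α] {P : ℕ → ℕ → α → Prop}
    (hmono : ∀ j k k' z, k ≤ k' → P j k' z → P j k z) (h : ∀ k, ∀ᶠ j in atTop, ∃ z, P j k z) :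
    ∃ z : ℕ → α, ∀ k, ∀ᶠ j in atTop, P j k (z j) := by
  classical
  let K : ℕ → ℕ := fun j => Nat.findGreatest (fun k => ∃ z, P j k z) j
  have hz : ∀ j, ∃ z, (∃ z, P j (K j) z) → P j (K j) z := fun j => by
    by_cases hj : ∃ z, P j (K j) z
    · exact ⟨hj.choose, fun _ => hj.choose_spec⟩
    · exact ⟨Classical.arbitrary α, fun h => absurd h hj⟩
  choose z hz using hz
  refine ⟨z, fun k => ?_⟩
  filter_upwards [h k, eventually_ge_atTop k] with j hj hkj
  have h1 : ∃ z, P j (K j) z := Nat.findGreatest_spec (P := fun k => ∃ z, P j k z) hkj hj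
  have h2 : k ≤ K j := Nat.le_findGreatest hkj hj
  exact hmono j k (K j) (z j) h2 (hz j h1)

section EpiConvergence

variable {n : ℕ} {H : Eucl n → EReal} {Hs : ℕ → Eucl n → EReal} {m : ℝ}

/-- The lower bound in the epi-convergence of Legendre transforms. -/
theorem eventually_lt_legendre (hH : IsClosedConvex H) (h0 : H 0 = m)
    (hconv : ∀ y, H y < ⊤ → ∀ t : ℝ, 0 ≤ t → t < 1 →
      Tendsto (fun j => Hs j (t • y)) atTop (𝓝 (H (t • y))))
    {xs : ℕ → Eucl n} {x : Eucl n} (hx : Tendsto xs atTop (𝓝 x)) {a : EReal}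
    (ha : a < legendre H x) : ∀ᶠ j in atTop, a < legendre (Hs j) (xs j) := by
  obtain ⟨a', haa', ha'⟩ := EReal.lt_iff_exists_real_btwn.mp ha
  refine Eventually.mono ?_ fun j hj => haa'.trans hj
  obtain ⟨y, hy⟩ := lt_iSup_iff.mp ha'
  have hytop : H y ≠ ⊤ := fun h => by simp [h] at hy
  have hc := EReal.coe_toReal hytop (hH.ne_bot y)
  set c := (H y).toReal
  rw [← hc] at hy
  norm_cast at hy
  -- Convergence is known only at t • y with t < 1, so y is pulled towards 0. Convexity bounds H
  -- there by the chord from H 0 = m, and the loss vanishes as t tends to 1.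
  obtain ⟨t, ht0, ht1, ht⟩ : ∃ t : ℝ, 0 < t ∧ t < 1 ∧
      a' < t * inner ℝ x y - (t * c + (1 - t) * m) := by
    have hcont : Tendsto (fun t : ℝ => t * inner ℝ x y - (t * c + (1 - t) * m)) (𝓝[<] 1)
        (𝓝 (inner ℝ x y - c)) := by
      have : Continuous fun t : ℝ => t * inner ℝ x y - (t * c + (1 - t) * m) := by fun_prop
      have h1 := (this.tendsto 1).mono_left (nhdsWithin_le_nhds (s := Set.Iio 1))
      simpa using h1
    obtain ⟨t, h1, h2⟩ := ((hcont.eventually_const_lt hy).and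
      (Ioo_mem_nhdsLT (zero_lt_one (α := ℝ)))).exists
    exact ⟨t, h2.1, h2.2, h1⟩
  have h1 : H (t • y) ≤ ((t * c + (1 - t) * m : ℝ) : EReal) := by
    have := hH.convex.le_of_le ht0 (sub_pos.mpr ht1) (by ring) hc.ge h0.le
    simpa using this
  obtain ⟨d, hd1, hd2⟩ := exists_between (lt_sub_comm.mp ht)
  have h2 : ∀ᶠ j in atTop, Hs j (t • y) < d :=
    (hconv y hytop.lt_top t ht0.le ht1).eventually_lt_const
      (h1.trans_lt (by exact_mod_cast hd1))
  have h3 : ∀ᶠ j in atTop, a' + d < inner ℝ (xs j) (t • y) := by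
    refine (hx.inner tendsto_const_nhds).eventually_const_lt ?_
    rw [inner_smul_right]
    linarith
  filter_upwards [h2, h3] with j hj2 hj3
  refine lt_of_lt_of_le ?_ (le_legendre hj2.le (xs j))
  norm_cast
  linarith

/-- The infimum of the conjugate is -H 0, by biconjugation at the origin. -/
theorem exists_legendre_lt (hH : IsClosedConvex H) (h0 : H 0 = m) {δ : ℝ} (hδ : 0 < δ) :
    ∃ p, legendre H p < ((-m + δ : ℝ) : EReal) := by
  by_contra! hp
  have h1 : legendre (legendre H) 0 ≤ ((m - δ : ℝ) : EReal) := by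
    rw [legendre_le_iff]
    intro p
    rw [inner_zero_left]
    refine le_trans (le_of_eq ?_) (hp p)
    congr 1
    ring
  rw [hH.legendre_legendre, h0] at h1
  norm_cast at h1
  linarith

/-- The upper bound in the epi-convergence of Legendre transforms. -/
theorem eventually_exists_legendre_lt (hHs : ∀ j, IsClosedConvex (Hs j)) {r C : ℝ} (hr : 0 < r)
    (hb : ∀ j x, ‖x‖ ≤ r → Hs j x ≤ C) (h0 : H 0 = m) (h0s : ∀ j, Hs j 0 = m)
    (hlim : ∀ k : ℕ → ℕ, StrictMono k → ∀ (ys : ℕ → Eucl n) (y : Eucl n),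
      Tendsto ys atTop (𝓝 y) → ∀ a : EReal, a < H y → ∀ᶠ j in atTop, a < Hs (k j) (ys j))
    {x : Eucl n} {s : ℝ} (hs : legendre H x = s) {δ : ℝ} (hδ : 0 < δ) :
    ∀ᶠ j in atTop, ∃ z, ‖z - x‖ < δ ∧ legendre (Hs j) z < ((s + δ : ℝ) : EReal) := by
  have hsm : -m ≤ s := by
    have := le_legendre h0.le x
    rw [hs, inner_zero_right] at this
    norm_cast at this
    linarith
  -- The candidates are proximal points z j at x with values ρ j ≥ -m. A bound ρ j + ‖x - z j‖ ^ 2 /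
  -- ε < s + 1 then yields ‖x - z j‖ < δ; as s ≥ -m, the summand 2 keeps the denominator positive.
  set ε : ℝ := δ ^ 2 / (s + m + 2) with hε
  have hsm2 : 0 < s + m + 2 := by linarith
  have hε0 : 0 < ε := by positivity
  choose z ρ hρ hz using fun j => (hHs j).legendre.exists_prox x hε0
  set y : ℕ → Eucl n := fun j => ε⁻¹ • (x - z j) with hy
  have hρm : ∀ j, -m ≤ ρ j := fun j => by
    have := le_legendre (h0s j).le (z j)
    rw [hρ, inner_zero_right] at this
    norm_cast at this
    linarith
  have hinner : ∀ j, inner ℝ (y j) (x - z j) = ‖x - z j‖ ^ 2 / ε := fun j => by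
    simp only [hy]
    rw [inner_smul_left, real_inner_self_eq_norm_sq]
    simp; ring
  have hval : ∀ j, Hs j (y j) ≤ ((inner ℝ (y j) x - (ρ j + ‖x - z j‖ ^ 2 / ε) : ℝ) : EReal) := by
    intro j
    rw [← (hHs j).legendre_legendre, legendre_le_iff]
    intro w
    refine le_trans (le_of_eq ?_) (hz j w)
    congr 1
    rw [← hinner, inner_sub_right, inner_sub_right]
    ring
  -- Points where the conjugate of `Hs j` is below -m + 1 stay in a fixed ball, by its growth at
  -- rate r. Testing the subgradient inequality at such a point bounds ‖x - z j‖ uniformly in j.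
  set P : ℝ := (C + 1 - m) / r + ‖x‖ with hP
  have hbound : ∀ j, ‖x - z j‖ ≤ |P| + ε + 1 := by
    intro j
    obtain ⟨p, hp⟩ := exists_legendre_lt (hHs j) (h0s j) zero_lt_one
    have h1 := (growth_legendre hr.le (hb j) p).trans hp.le
    norm_cast at h1
    have hpn : ‖p - x‖ ≤ P := by
      refine (norm_sub_le _ _).trans ?_
      rw [hP]
      gcongr
      rw [le_div_iff₀ hr]
      linarith
    have h2 := (hz j p).trans hp.le
    norm_cast at h2
    have h3 : p - z j = (p - x) + (x - z j) := by abel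
    rw [h3, inner_add_right, hinner, inner_smul_left] at h2
    simp only [conj_trivial] at h2
    have h4 := (abs_le.mp (abs_real_inner_le_norm (x - z j) (p - x))).1
    have h5 : ‖x - z j‖ * ‖p - x‖ ≤ ‖x - z j‖ * |P| := by
      gcongr
      exact hpn.trans (le_abs_self P)
    have h6 := hρm j
    set d := ‖x - z j‖
    set q := inner ℝ (x - z j) (p - x)
    have h7 : q + d ^ 2 ≤ ε := by
      have : ε⁻¹ * (q + d ^ 2) ≤ 1 := by
        rw [mul_add, ← div_eq_inv_mul _ ε, ← div_eq_inv_mul _ ε]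
        rw [← div_eq_inv_mul _ ε] at h2
        linarith
      rwa [inv_mul_le_iff₀ hε0, mul_one] at this
    have hd0 : 0 ≤ d := norm_nonneg _
    have hP0 := abs_nonneg P
    by_contra! hlt
    nlinarith
  by_contra hnot
  rw [not_eventually] at hnot
  obtain ⟨k, hk, hbad⟩ := extraction_of_frequently_atTop hnot
  have hybound : ∀ j, y (k j) ∈ Metric.closedBall (0 : Eucl n) (ε⁻¹ * (|P| + ε + 1)) := by
    intro j
    rw [mem_closedBall_zero_iff]
    simp only [hy]
    rw [norm_smul, Real.norm_of_nonneg (by positivity)]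
    gcongr
    exact hbound _
  -- Along bad indices the slopes have a limit y₀. The lower limit hypothesis bounds `Hs` below near
  -- H y₀, which is at least ⟪y₀, x⟫ - s, while `hval` bounds it above; together they make the
  -- proximal value less than s + η.
  obtain ⟨y₀, -, φ, hφ, hlimy⟩ := tendsto_subseq_of_bounded Metric.isBounded_closedBall hybound
  -- The bound 1 controls the distance to x through the choice of ε; the bound δ controls the value.
  set η : ℝ := min δ 1 with hη
  have hη0 : 0 < η := lt_min hδ one_pos
  have hHy : ((inner ℝ y₀ x - s - η / 2 : ℝ) : EReal) < H y₀ := by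
    by_contra! hle
    have := le_legendre hle x
    rw [hs, real_inner_comm] at this
    norm_cast at this
    linarith
  have h1 := hlim (fun j => k (φ j)) (hk.comp hφ) (fun j => y (k (φ j))) y₀ hlimy _ hHy
  have h2 : ∀ᶠ j in atTop, inner ℝ (y (k (φ j))) x < inner ℝ y₀ x + η / 2 :=
    (hlimy.inner tendsto_const_nhds).eventually_lt_const (by linarith)
  obtain ⟨j, hj1, hj2⟩ := (h1.and h2).exists
  set i := k (φ j) with hi
  have h3 := hj1.trans_le (hval i)
  norm_cast at h3
  have h4 : ρ i + ‖x - z i‖ ^ 2 / ε < s + η := by linarith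
  have h5 : 0 ≤ ‖x - z i‖ ^ 2 / ε := by positivity
  refine hbad (φ j) ⟨z i, ?_, ?_⟩
  · have h6 : ‖x - z i‖ ^ 2 / ε < s + m + 2 := by
      have := hρm i
      have : η ≤ 1 := min_le_right _ _
      linarith
    rw [div_lt_iff₀ hε0, hε, mul_div_cancel₀ _ hsm2.ne'] at h6
    rw [norm_sub_rev]
    exact lt_of_pow_lt_pow_left₀ 2 hδ.le h6
  · have : legendre (Hs i) (z i) = ρ i := hρ i
    rw [this]
    norm_cast
    have : η ≤ δ := min_le_left _ _
    linarith

/-- Epi-convergence of Legendre transforms, stated as hypo-convergence of the log-concave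
functions that they define. -/
theorem hypoTendsto_expNeg_legendre (hH : IsClosedConvex H) (hHs : ∀ j, IsClosedConvex (Hs j))
    {r C : ℝ} (hr : 0 < r) (hb : ∀ j x, ‖x‖ ≤ r → Hs j x ≤ C) (h0 : H 0 = m)
    (h0s : ∀ j, Hs j 0 = m)
    (hlim : ∀ k : ℕ → ℕ, StrictMono k → ∀ (ys : ℕ → Eucl n) (y : Eucl n),
      Tendsto ys atTop (𝓝 y) → ∀ a : EReal, a < H y → ∀ᶠ j in atTop, a < Hs (k j) (ys j))
    (hconv : ∀ y, H y < ⊤ → ∀ t : ℝ, 0 ≤ t → t < 1 →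
      Tendsto (fun j => Hs j (t • y)) atTop (𝓝 (H (t • y))))
    {fs : ℕ → LCc n} {f : LCc n} (hfs : ∀ j, (fs j).1 = expNeg (legendre (Hs j)))
    (hf : f.1 = expNeg (legendre H)) : HypoTendsto fs f := by
  intro x
  simp only [hfs, hf, expNeg]
  constructor
  · intro xs hxs
    refine le_of_forall_gt_imp_ge_of_dense fun c hc => ?_
    obtain ⟨a, rfl⟩ : ∃ a : EReal, EReal.exp (-a) = c :=
      ⟨-(EReal.expOrderIso.symm c), by
        rw [neg_neg, ← EReal.expOrderIso_apply, OrderIso.apply_symm_apply]⟩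
    rw [EReal.exp_lt_exp_iff, EReal.neg_lt_neg_iff] at hc
    refine limsup_le_of_le (by isBoundedDefault) ?_
    filter_upwards [eventually_lt_legendre hH h0 hconv hxs hc] with j hj
    rw [EReal.exp_le_exp_iff, EReal.neg_le_neg_iff]
    exact hj.le
  · suffices hrec : ∃ xs : ℕ → Eucl n, Tendsto xs atTop (𝓝 x) ∧
        Tendsto (fun j => legendre (Hs j) (xs j)) atTop (𝓝 (legendre H x)) by
      obtain ⟨xs, hxs, hlx⟩ := hrec
      exact ⟨xs, hxs, (EReal.expHomeomorph.continuous.tendsto _).comp hlx.neg⟩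
    by_cases htop : legendre H x = ⊤
    -- Where the limit is ⊤ the lower bound alone gives convergence along the constant sequence.
    · refine ⟨fun _ => x, tendsto_const_nhds, tendsto_order.mpr ⟨fun a ha => ?_, fun a ha => ?_⟩⟩
      · exact eventually_lt_legendre hH h0 hconv tendsto_const_nhds ha
      · rw [htop] at ha
        exact absurd ha not_top_lt
    have hs := (EReal.coe_toReal htop (hH.legendre.ne_bot x)).symm
    set s := (legendre H x).toReal
    obtain ⟨z, hz⟩ := exists_seq_of_eventually_exists
      (P := fun j k z => ‖z - x‖ < 1 / ((k : ℝ) + 1) ∧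
        legendre (Hs j) z < ((s + 1 / ((k : ℝ) + 1) : ℝ) : EReal))
      (by
        rintro j k k' z hk ⟨h1, h2⟩
        have h3 : 1 / ((k' : ℝ) + 1) ≤ 1 / ((k : ℝ) + 1) := by gcongr
        exact ⟨h1.trans_le h3, h2.trans_le (by exact_mod_cast add_le_add_right h3 s)⟩)
      (fun k => eventually_exists_legendre_lt hHs hr hb h0 h0s hlim hs (by positivity))
    have hzx : Tendsto z atTop (𝓝 x) := by
      rw [tendsto_iff_norm_sub_tendsto_zero]
      refine tendsto_order.mpr ⟨fun a ha => Eventually.of_forall fun j => ha.trans_le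
        (norm_nonneg _), fun a ha => ?_⟩
      obtain ⟨k, hk⟩ := exists_nat_one_div_lt ha
      exact (hz k).mono fun j hj => hj.1.trans hk
    refine ⟨z, hzx, tendsto_order.mpr ⟨fun a ha => ?_, fun b hb => ?_⟩⟩
    · exact eventually_lt_legendre hH h0 hconv hzx ha
    · rw [hs] at hb
      obtain ⟨c, hc1, hc2⟩ := EReal.lt_iff_exists_real_btwn.mp hb
      obtain ⟨k, hk⟩ := exists_nat_one_div_lt (sub_pos.mpr (EReal.coe_lt_coe_iff.mp hc1))
      refine (hz k).mono fun j hj => hj.2.trans (lt_trans ?_ hc2)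
      exact EReal.coe_lt_coe_iff.mpr (by linarith)

end EpiConvergence

/-! ### Rotational symmetrizations -/

theorem expNeg_injective {n : ℕ} {u v : Eucl n → EReal} (h : expNeg u = expNeg v) : u = v := by
  funext x
  have hx : EReal.exp (-u x) = EReal.exp (-v x) := congrFun h x
  exact neg_injective (EReal.exp_strictMono.injective hx)

theorem IsConvC.exists_legendre_bound {n : ℕ} {u : Eucl n → EReal} (hu : IsConvC u) :
    ∃ r C m : ℝ, 0 < r ∧ (∀ x, ‖x‖ ≤ r → legendre u x ≤ C) ∧ legendre u 0 = m := by
  obtain ⟨r, C, hr, h⟩ := hu.exists_growth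
  have hb : ∀ x, ‖x‖ ≤ r → legendre u x ≤ C := fun x hx => legendre_le_of_growth h hx
  have h0 := (hb 0 (by simpa using hr.le)).trans_lt (EReal.coe_lt_top _)
  exact ⟨r, C, _, hr, hb,
    (EReal.coe_toReal h0.ne (hu.isClosedConvex.legendre.ne_bot 0)).symm⟩

theorem legendre_rotAvg_isConvC {n : ℕ} {u : Eucl n → EReal} (hu : IsConvC u) {s : SO n → SO n}
    (hs : Measurable s) : IsConvC (legendre (rotAvg s (legendre u))) := by
  obtain ⟨r, C, m, hr, hb, h0⟩ := hu.exists_legendre_bound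
  have hh := hu.isClosedConvex.legendre
  exact (hh.rotAvg hs h0).legendre.isConvC hr
    (growth_legendre hr.le fun x hx => rotAvg_le_of_le hh hs hb hx)

theorem legendre_legendre_rotAvg {n : ℕ} {u : Eucl n → EReal} (hu : IsConvC u) {s : SO n → SO n}
    (hs : Measurable s) : legendre (legendre (rotAvg s (legendre u))) = rotAvg s (legendre u) := by
  obtain ⟨r, C, m, hr, hb, h0⟩ := hu.exists_legendre_bound
  exact (hu.isClosedConvex.legendre.rotAvg hs h0).legendre_legendre

/-- The average is itself closed and convex, so by Fenchel-Moreau it is the conjugate of its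
conjugate; injectivity of the transform excludes any other solution. -/
theorem isRotEpiSymm_iff_of_two_le {n : ℕ} (hn : 2 ≤ n) {u φ : Eucl n → EReal} (hu : IsConvC u) :
    IsRotEpiSymm u φ ↔ φ = legendre (rotAvg id (legendre u)) := by
  constructor
  · intro h
    refine h.mem.legendre_injective (legendre_rotAvg_isConvC hu measurable_id) ?_
    rw [legendre_legendre_rotAvg hu measurable_id]
    exact funext (h.eq_average hn)
  · rintro rfl
    refine ⟨legendre_rotAvg_isConvC hu measurable_id, fun _ x => ?_, fun h => by omega⟩
    rw [legendre_legendre_rotAvg hu measurable_id]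
    rfl

theorem IsConvC.reflect {n : ℕ} {u : Eucl n → EReal} (hu : IsConvC u) :
    IsConvC fun x => u (-x) where
  ne_bot x := hu.ne_bot _
  convex x y a b ha hb hab := by
    have h : -(a • x + b • y) = a • -x + b • -y := by module
    simp only [h]
    exact hu.convex _ _ a b ha hb hab
  coercive := hu.coercive.comp (Homeomorph.neg (Eucl n)).isClosedEmbedding.tendsto_cocompact
  proper := by
    obtain ⟨x, hx⟩ := hu.proper
    exact ⟨-x, by rwa [neg_neg]⟩
  lsc := hu.lsc.comp continuous_neg

theorem isRotEpiSymm_one_iff {u φ : Eucl 1 → EReal} (hu : IsConvC u) :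
    IsRotEpiSymm u φ ↔ φ = epiMean (1 / 2) u (fun x => u (-x)) := by
  constructor
  · intro h
    rw [h.eq_reflect rfl, epiMul_infConv_reflect]
  · rintro rfl
    exact ⟨epiMean_isConvC (by norm_num) (by norm_num) hu hu.reflect, fun h => by omega,
      fun _ => (epiMul_infConv_reflect u).symm⟩

/-- If the rotational epi-symmetrization of `u` is determined, then so is the rotational
hypo-symmetrization of `e^{-u}`. -/
theorem isRotHypoSymm_iff {n : ℕ} {u φ : Eucl n → EReal} (hu : IsConvC u)
    (h : ∀ φ', IsRotEpiSymm u φ' ↔ φ' = φ) (g : LCc n) :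
    IsRotHypoSymm ⟨_, mem_LCc_of_isConvC hu⟩ g ↔ g.1 = expNeg φ := by
  constructor
  · rintro ⟨u', φ', hu', he, hφ', hg⟩
    obtain rfl := expNeg_injective he
    rw [hg, (h φ').mp hφ']
  · intro hg
    exact ⟨u, φ, hu, rfl, (h φ).mpr rfl, hg⟩

/-- Functionals that are log-convex, rotation invariant and lower semicontinuous do not increase
under averaging over the rotation group. -/
theorem legendre_rotAvg_le {n : ℕ} (hn : 2 ≤ n) {G : LCc n → ℝ≥0∞} (hlsc : HypoLSC G)
    (hG : IsLogConvexFunctional G) (hrot : RotInvariant G) {u : Eucl n → EReal} (hu : IsConvC u) :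
    G ⟨_, mem_LCc_of_isConvC (legendre_rotAvg_isConvC hu measurable_id)⟩ ≤
      G ⟨_, mem_LCc_of_isConvC hu⟩ := by
  obtain ⟨ss, hss⟩ := SO.exists_simpleFunc_tendsto n
  obtain ⟨r, C, m, hr, hb, h0⟩ := hu.exists_legendre_bound
  have hh := hu.isClosedConvex.legendre
  have hmeas : ∀ j, Measurable (ss j) := fun j => (ss j).measurable
  have hle : ∀ j, G ⟨_, mem_LCc_of_isConvC (legendre_rotAvg_isConvC hu (hmeas j))⟩ ≤
      G ⟨_, mem_LCc_of_isConvC hu⟩ := by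
    intro j
    obtain ⟨T, w, hT, hpos, hsum, hw⟩ := rotAvg_simpleFunc hh (ss j)
    obtain ⟨ψ, hψ, hL, hGψ⟩ := exists_finite_epiMean hG hrot hu hT w hpos hsum
    -- Both functions have the same Legendre transform, so the iterated epi-mean is the j-th
    -- approximant.
    obtain rfl : ψ = legendre (rotAvg (ss j) (legendre u)) := by
      refine hψ.legendre_injective (legendre_rotAvg_isConvC hu (hmeas j)) ?_
      rw [legendre_legendre_rotAvg hu (hmeas j)]
      exact funext fun x => (hL x).trans (hw x).symm
    exact hGψ
  refine (hlsc (fun j => ⟨_, mem_LCc_of_isConvC (legendre_rotAvg_isConvC hu (hmeas j))⟩) _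
    (hypoTendsto_expNeg_legendre (hh.rotAvg measurable_id h0) (fun j => hh.rotAvg (hmeas j) h0) hr
      (fun j x hx => rotAvg_le_of_le hh (hmeas j) hb hx) (rotAvg_zero hh measurable_id h0)
      (fun j => rotAvg_zero hh (hmeas j) h0) ?_ ?_ (fun _ => rfl) rfl)).trans ?_
  · intro k hk ys y hy a ha
    exact eventually_lt_rotAvg hh measurable_id (fun j => hmeas (k j))
      (fun θ => (hss θ).comp hk.tendsto_atTop) hy ha
  · intro y hy t ht0 ht1
    exact tendsto_rotAvg_smul hn hh hr hb hmeas hss hy ht0 ht1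
  · exact liminf_le_of_le (by isBoundedDefault) fun b hb => by
      obtain ⟨j, hj⟩ := hb.exists
      exact hj.trans (hle j)

theorem mainTheorem7 :
    (∀ n : ℕ, 2 ≤ n → ∀ G : LCc n → ℝ≥0∞, OneSided G → HypoLSC G → IsLogConvexFunctional G →
      RotInvariant G →
      ∀ f : LCc n, (∃! g : LCc n, IsRotHypoSymm f g) ∧
        ∀ fRot : LCc n, IsRotHypoSymm f fRot → G fRot ≤ G f) ∧
    (∀ G : LCc 1 → ℝ≥0∞, OneSided G → IsLogConvexFunctional G → ReflInvariant G →
      ∀ f : LCc 1, (∃! g : LCc 1, IsRotHypoSymm f g) ∧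
        ∀ fRot : LCc 1, IsRotHypoSymm f fRot → G fRot ≤ G f) := by
  constructor
  · rintro n hn G - hlsc hG hrot ⟨_, u, hu, rfl⟩
    have key := isRotHypoSymm_iff hu fun φ => isRotEpiSymm_iff_of_two_le (φ := φ) hn hu
    refine ⟨⟨⟨_, mem_LCc_of_isConvC (legendre_rotAvg_isConvC hu measurable_id)⟩,
      (key _).mpr rfl, fun g hg => Subtype.ext ((key g).mp hg)⟩, fun fRot hf => ?_⟩
    rw [show fRot = ⟨_, mem_LCc_of_isConvC (legendre_rotAvg_isConvC hu measurable_id)⟩ from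
      Subtype.ext ((key fRot).mp hf)]
    exact legendre_rotAvg_le hn hlsc hG hrot hu
  · rintro G - hG hrefl ⟨_, u, hu, rfl⟩
    have key := isRotHypoSymm_iff hu fun φ => isRotEpiSymm_one_iff (φ := φ) hu
    have hmean := epiMean_isConvC (l := 1 / 2) (by norm_num) (by norm_num) hu hu.reflect
    refine ⟨⟨⟨_, mem_LCc_of_isConvC hmean⟩,
      (key _).mpr rfl, fun g hg => Subtype.ext ((key g).mp hg)⟩, fun fRot hf => ?_⟩
    rw [show fRot = ⟨_, mem_LCc_of_isConvC hmean⟩ from Subtype.ext ((key fRot).mp hf)]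
    -- A single epi-mean of u and its reflection; no limit is involved.
    exact hG.epiMean_le hu hu.reflect (by norm_num) (by norm_num) le_rfl
      (hrefl _ _ fun _ => rfl).le
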